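/- **Setting.** For $a<b$ let $\mathrm S(a,b)=\{\zeta\in\mathbb C: a<\operatorname{Im}\zeta<b\}$. A *scattering function* is a bounded continuous function $S:\overline{\mathrm S(0,\pi)}\to\mathbb C$, analytic in $\mathrm S(0,\pi)$, with $\overline{S(\theta)}=S(\theta)^{-1}=S(\theta+i\pi)=S(-\theta)$ for $\theta\in\mathbb R$. Let $\mathcal S_{\rm lim}$ be the set of scattering functions which continue to a bounded analytic function on $\mathrm S(-\kappa,\pi+\kappa)$ for some $\kappa>0$ and for which $\lim_{\theta\to\infty}S(\theta)=:S(\infty)$ and $\lim_{\theta\to-\infty}S(\theta)$ exist. For $m\ge 0$ put $\omega^m_p=(p^2+m^2)^{1/2}$. For $m>0$ let $$S_m(p,q)=S\Big(\sinh^{-1}\frac{p\,\omega^m_q-q\,\omega^m_p}{m^2}\Big),$$ and let $S_0(p,q)$ be $S(\log p-\log q)$ if $p,q>0$, $S(\log(-q)-\log(-p))$ if $p,q<0$, $S(0)$ if $p=q=0$, and $S(\infty)$ otherwise. For $m\ge0$ let $\mathcal H_{m,1}=L^2(\mathbb R,dp/\omega^m_p)$, let $\mathcal H_{m,n}\subset\mathcal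 H_{m,1}^{\otimes n}$ be the closed subspace of all $\Psi_n$ with $$\Psi_n(p_1,\dots,p_n)=S_m(p_{j+1},p_j)\,\Psi_n(p_1,\dots,p_{j+1},p_j,\dots,p_n)\quad\text{a.e.},\qquad j=1,\dots,n-1,$$ let $P_n$ be the orthogonal projection onto it, $\mathcal H_m=\bigoplus_{n\ge0}\mathcal H_{m,n}$ with $\mathcal H_{m,0}=\mathbb C$, $\Omega_m=1\oplus0\oplus0\oplus\cdots$, and let $\mathcal D_m\subset\mathcal H_m$ be the subspace of vectors with finite particle number. For $\varphi\in\mathcal H_{m,1}$ define on $\mathcal D_m$ $$(z_m(\varphi)\Psi)_n(p_1,\dots,p_n)=\sqrt{n+1}\int\frac{dq}{\omega^m_q}\,\varphi(q)\Psi_{n+1}(q,p_1,\dots,p_n),\qquad (z_m^\dagger(\varphi)\Psi)_n=\sqrt n\,P_n(\varphi\otimes\Psi_{n-1}),$$ and $(U_m(j)\Psi)_n(p_1,\dots,p_n)=\overline{\Psi_n(p_n,\dots,p_1)}$. For a (complex-valued) Schwartz function $f\in\mathscr S(\mathbb R^2)$ let $$f^{m\pm}(p)=\frac1{2\pi}\int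 d^2x\,f(x)\,e^{\pm i(\omega^m_px_0-p\,x_1)},$$ which lies in $\mathcal H_{m,1}$ if $m>0$, or if $m=0$ and $f^{0\pm}(0)=0$. For such $f$ define $$\phi_m(f)=z_m^\dagger(f^{m+})+z_m(f^{m-}),\qquad \phi_m'(f)=U_m(j)\,\phi_m(f^j)\,U_m(j)^{-1},\quad f^j(x)=\overline{f(-x)},$$ as operators on $\mathcal D_m$, and for $\lambda>0$ let $f_\lambda(x)=\lambda^{-2}f(\lambda^{-1}x)$. **Proposition.** Let $m>0$, $S\in\mathcal S_{\rm lim}$, $n\ge 0$, and let $f_1,\dots,f_n\in\mathscr S(\mathbb R^2)$ satisfy $f_j^{0\pm}(0)=0$ for $j=1,\dots,n$. Then $$\lim_{\lambda\downarrow0}\langle\Omega_m,\phi_m(f_{1,\lambda})\cdots\phi_m(f_{n,\lambda})\Omega_m\rangle=\langle\Omega_0,\phi_0(f_1)\cdots\phi_0(f_n)\Omega_0\rangle,$$ and likewise $$\lim_{\lambda\downarrow0}\langle\Omega_m,\phi_m'(f_{1,\lambda})\cdots\phi_m'(f_{n,\lambda})\Omega_m\rangle=\langle\Omega_0,\phi_0'(f_1)\cdots\phi_0'(f_n)\Omega_0\rangle,$$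 where $\phi_0,\phi_0'$ are the massless fields built from the same $S$. -/

import Mathlib

open MeasureTheory Filter Topology
open scoped ComplexConjugate ENNReal SchwartzMap FourierTransform

namespace FactorizingModel

noncomputable section

/-- The closed strip `{ζ : a ≤ Im ζ ≤ b}`. -/
def closedStrip (a b : ℝ) : Set ℂ := {ζ | a ≤ ζ.im ∧ ζ.im ≤ b}

/-- The open strip `{ζ : a < Im ζ < b}`. -/
def openStrip (a b : ℝ) : Set ℂ := {ζ | a < ζ.im ∧ ζ.im < b}

/-- Scattering functions on the closed strip `0 ≤ Im ζ ≤ π`; values of `S` outside this strip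
play no role. -/
structure IsScatteringFunction (S : ℂ → ℂ) : Prop where
  bounded : ∃ C : ℝ, ∀ ζ ∈ closedStrip 0 Real.pi, ‖S ζ‖ ≤ C
  continuousOn : ContinuousOn S (closedStrip 0 Real.pi)
  analytic : DifferentiableOn ℂ S (openStrip 0 Real.pi)
  ne_zero : ∀ θ : ℝ, S θ ≠ 0
  conj_eq_inv : ∀ θ : ℝ, conj (S θ) = (S θ)⁻¹
  inv_eq_crossing : ∀ θ : ℝ, (S θ)⁻¹ = S (θ + Complex.I * Real.pi)
  crossing_eq_neg : ∀ θ : ℝ, S (θ + Complex.I * Real.pi) = S (-θ)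

/-- Regular scattering functions: `S` continues to a bounded analytic function on a strip
`-κ < Im ζ < π + κ` with `κ > 0`. -/
structure IsRegularScatteringFunction (S : ℂ → ℂ) : Prop extends IsScatteringFunction S where
  regular : ∃ κ : ℝ, 0 < κ ∧ ∃ T : ℂ → ℂ,
    Set.EqOn T S (closedStrip 0 Real.pi) ∧
    DifferentiableOn ℂ T (openStrip (-κ) (Real.pi + κ)) ∧
    ∃ C : ℝ, ∀ ζ ∈ openStrip (-κ) (Real.pi + κ), ‖T ζ‖ ≤ C

/-- Scattering functions with limit. -/
structure IsScatteringFunctionWithLimit (S : ℂ → ℂ) : Prop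
    extends IsRegularScatteringFunction S where
  limit_atTop : ∃ a : ℂ, Tendsto (fun θ : ℝ => S θ) atTop (𝓝 a)
  limit_atBot : ∃ b : ℂ, Tendsto (fun θ : ℝ => S θ) atBot (𝓝 b)

/-- The energy `ω_p^m = (p² + m²)^{1/2}`. -/
def energy (m p : ℝ) : ℝ := Real.sqrt (p ^ 2 + m ^ 2)

/-- `S_m(p, q)` for `m > 0`. -/
def massiveKernel (S : ℂ → ℂ) (m p q : ℝ) : ℂ :=
  S (Real.arsinh ((p * energy m q - q * energy m p) / m ^ 2))

/-- `S(∞) = lim_{θ → ∞} S(θ)`. -/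
def limitValue (S : ℂ → ℂ) : ℂ := limUnder atTop (fun θ : ℝ => S θ)

open Classical in
/-- The massless function `S_0(p, q)`. -/
def masslessKernel (S : ℂ → ℂ) (p q : ℝ) : ℂ :=
  if 0 < p ∧ 0 < q then S ((Real.log p - Real.log q : ℝ) : ℂ)
  else if p < 0 ∧ q < 0 then S ((Real.log (-q) - Real.log (-p) : ℝ) : ℂ)
  else if p = 0 ∧ q = 0 then S 0
  else limitValue S

open Classical in
/-- `S_m(p, q)` for `m ≥ 0`. -/
def kernel (S : ℂ → ℂ) (m : ℝ) : ℝ → ℝ → ℂ :=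
  if m = 0 then masslessKernel S else massiveKernel S m

theorem kernel_unitary {S : ℂ → ℂ} (hS : IsScatteringFunctionWithLimit S) (m p q : ℝ) :
    kernel S m p q * conj (kernel S m p q) = 1 := by
  have h : ∀ θ : ℝ, S θ * conj (S θ) = 1 := fun θ => by
    rw [hS.conj_eq_inv, mul_inv_cancel₀ (hS.ne_zero θ)]
  have hlim : limitValue S * conj (limitValue S) = 1 := by
    have ht : Tendsto (fun θ : ℝ => S θ) atTop (𝓝 (limitValue S)) :=
      tendsto_nhds_limUnder hS.limit_atTop
    have h2 := ht.mul ((Complex.continuous_conj.tendsto _).comp ht)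
    refine tendsto_nhds_unique h2 ?_
    refine tendsto_const_nhds.congr fun θ => ?_
    exact (h θ).symm
  rw [kernel]
  split_ifs
  · rw [masslessKernel]
    split_ifs
    · exact h _
    · exact h _
    · simpa using h 0
    · exact hlim
  · exact h _

/-- The measure `dp / ω_p^m` on momentum space. -/
def momentumMeasure (m : ℝ) : Measure ℝ :=
  volume.withDensity fun p => ENNReal.ofReal (energy m p)⁻¹

instance (m : ℝ) : SigmaFinite (momentumMeasure m) := by
  unfold momentumMeasure; infer_instance

/-- Two-dimensional Minkowski space as a vector space, with coordinates `x 0` (time) and `x 1`. -/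
abbrev Spacetime : Type := EuclideanSpace ℝ (Fin 2)

/-- `f^{m±}(p) = (2π)⁻¹ ∫ f(x) exp(± i (ω_p^m x₀ - p x₁)) d²x`, with `ε = ± 1` the sign. -/
def massShell (ε m : ℝ) (f : 𝓢(Spacetime, ℂ)) (p : ℝ) : ℂ :=
  (1 / (2 * Real.pi) : ℂ) *
    ∫ x : Spacetime, f x * Complex.exp (ε * Complex.I * (energy m p * x 0 - p * x 1 : ℝ))

/-- The point at which the Fourier transform is evaluated in `massShell`. -/
def shellPoint (ε m p : ℝ) : Spacetime :=
  !₂[-(ε * energy m p / (2 * Real.pi)), ε * p / (2 * Real.pi)]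

theorem massShell_eq (ε m : ℝ) (f : 𝓢(Spacetime, ℂ)) (p : ℝ) :
    massShell ε m f p = (1 / (2 * Real.pi) : ℂ) * 𝓕 f (shellPoint ε m p) := by
  rw [massShell, SchwartzMap.fourier_coe, Real.fourier_eq']
  congr 2
  funext x
  rw [smul_eq_mul, mul_comm]
  congr 2
  have : inner ℝ x (shellPoint ε m p)
      = -(ε * (energy m p * x 0 - p * x 1)) / (2 * Real.pi) := by
    simp [shellPoint, PiLp.inner_apply, Fin.sum_univ_two]
    ring
  rw [this]
  have hpi : (Real.pi : ℂ) ≠ 0 := by exact_mod_cast Real.pi_ne_zero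
  push_cast
  field_simp

theorem continuous_shellPoint (ε m : ℝ) : Continuous (shellPoint ε m) := by
  unfold shellPoint energy
  fun_prop

theorem continuous_massShell (ε m : ℝ) (f : 𝓢(Spacetime, ℂ)) : Continuous (massShell ε m f) := by
  rw [funext (massShell_eq ε m f)]
  exact continuous_const.mul ((𝓕 f).continuous.comp (continuous_shellPoint ε m))

theorem massShell_decay {ε : ℝ} (hε : ε ^ 2 = 1) (m : ℝ) (f : 𝓢(Spacetime, ℂ)) :
    ∃ C : ℝ, ∀ p, ‖massShell ε m f p‖ ≤ C * (1 + p ^ 2)⁻¹ := by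
  obtain ⟨A, hA0, hA⟩ := (𝓕 f).decay 0 0
  obtain ⟨B, hB0, hB⟩ := (𝓕 f).decay 2 0
  refine ⟨A + 4 * Real.pi ^ 2 * B, fun p => ?_⟩
  have h1 := hA (shellPoint ε m p)
  have h2 := hB (shellPoint ε m p)
  simp only [norm_iteratedFDeriv_zero, pow_zero, one_mul] at h1 h2
  have hn : p ^ 2 ≤ 4 * Real.pi ^ 2 * ‖shellPoint ε m p‖ ^ 2 := by
    rw [EuclideanSpace.norm_sq_eq]
    simp only [shellPoint, Fin.sum_univ_two, Real.norm_eq_abs, sq_abs]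
    have : 4 * Real.pi ^ 2 * ((-(ε * energy m p / (2 * Real.pi))) ^ 2 +
        (ε * p / (2 * Real.pi)) ^ 2) = ε ^ 2 * (energy m p ^ 2 + p ^ 2) := by
      field_simp
      ring
    simp only [Matrix.cons_val_zero, Matrix.cons_val_one]
    rw [this, hε]
    nlinarith [sq_nonneg (energy m p)]
  rw [massShell_eq, norm_mul, ← div_eq_mul_inv, le_div_iff₀ (by positivity)]
  have hc : ‖(1 / (2 * Real.pi) : ℂ)‖ ≤ 1 := by
    have : (1 / (2 * Real.pi) : ℂ) = ((1 / (2 * Real.pi) : ℝ) : ℂ) := by push_cast; rfl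
    rw [this, Complex.norm_real, Real.norm_of_nonneg (by positivity)]
    rw [div_le_one (by positivity)]
    linarith [Real.pi_gt_three]
  have hg := norm_nonneg (𝓕 f (shellPoint ε m p))
  calc ‖(1 / (2 * Real.pi) : ℂ)‖ * ‖𝓕 f (shellPoint ε m p)‖ * (1 + p ^ 2)
      ≤ 1 * ‖𝓕 f (shellPoint ε m p)‖ *
        (1 + 4 * Real.pi ^ 2 * ‖shellPoint ε m p‖ ^ 2) := by gcongr
    _ = ‖𝓕 f (shellPoint ε m p)‖ +
        4 * Real.pi ^ 2 * (‖shellPoint ε m p‖ ^ 2 * ‖𝓕 f (shellPoint ε m p)‖) := by ring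
    _ ≤ _ := by gcongr

theorem memLp_massShell_of_bound {ε m : ℝ} (f : 𝓢(Spacetime, ℂ)) (C : ℝ)
    (h : ∀ p, (energy m p)⁻¹ * ‖massShell ε m f p‖ ^ 2 ≤ C * (1 + p ^ 2)⁻¹) :
    MemLp (massShell ε m f) 2 (momentumMeasure m) := by
  have hω : Continuous (energy m) := by unfold energy; fun_prop
  have hωm : Measurable fun p => (energy m p)⁻¹ := hω.measurable.inv
  have hω0 : ∀ p, 0 ≤ energy m p := fun p => Real.sqrt_nonneg _
  have hF := continuous_massShell ε m f
  rw [memLp_two_iff_integrable_sq_norm hF.aestronglyMeasurable, momentumMeasure,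
    integrable_withDensity_iff_integrable_smul' (by fun_prop) (by simp)]
  refine (integrable_inv_one_add_sq.const_mul C).mono' ?_ ?_
  · refine Measurable.aestronglyMeasurable ?_
    have := hF.measurable
    fun_prop
  · refine Eventually.of_forall fun p => ?_
    rw [ENNReal.toReal_ofReal (inv_nonneg.2 (hω0 p)), smul_eq_mul,
      Real.norm_of_nonneg (mul_nonneg (inv_nonneg.2 (hω0 p)) (by positivity))]
    exact h p

/-- `f^{m±} ∈ L²(ℝ, dp/ω_p^m)` for `m > 0`. -/
theorem memLp_massShell_of_pos {ε m : ℝ} (hε : ε ^ 2 = 1) (hm : 0 < m) (f : 𝓢(Spacetime, ℂ)) :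
    MemLp (massShell ε m f) 2 (momentumMeasure m) := by
  obtain ⟨C, hC⟩ := massShell_decay hε m f
  have hC0 : 0 ≤ C := by simpa using (norm_nonneg _).trans (hC 0)
  refine memLp_massShell_of_bound f (m⁻¹ * C ^ 2) fun p => ?_
  have h1 : m ≤ energy m p := Real.le_sqrt_of_sq_le (by nlinarith [sq_nonneg p])
  have h2 : (1 + p ^ 2)⁻¹ ≤ (1 : ℝ) := inv_le_one_of_one_le₀ (by nlinarith [sq_nonneg p])
  calc (energy m p)⁻¹ * ‖massShell ε m f p‖ ^ 2
      ≤ m⁻¹ * (C * (1 + p ^ 2)⁻¹) ^ 2 := by gcongr; exact hC p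
    _ = m⁻¹ * C ^ 2 * ((1 + p ^ 2)⁻¹ * (1 + p ^ 2)⁻¹) := by ring
    _ ≤ m⁻¹ * C ^ 2 * ((1 + p ^ 2)⁻¹ * 1) := by gcongr
    _ = _ := by ring

/-- `f^{0±} ∈ L²(ℝ, dp/|p|)` if `f^{0±}(0) = 0`. -/
theorem memLp_massShell_zero {ε : ℝ} (hε : ε ^ 2 = 1) (f : 𝓢(Spacetime, ℂ))
    (hf : massShell ε 0 f 0 = 0) :
    MemLp (massShell ε 0 f) 2 (momentumMeasure 0) := by
  obtain ⟨C, hC⟩ := massShell_decay hε 0 f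
  obtain ⟨B, hB0, hB⟩ := (𝓕 f).decay 0 1
  have hω : ∀ p, energy 0 p = |p| := fun p => by simp [energy, Real.sqrt_sq_eq_abs]
  have hlip : ∀ p, ‖massShell ε 0 f p‖ ≤ B * |p| := by
    intro p
    have h0 : 𝓕 f (shellPoint ε 0 0) = 0 := by
      rw [massShell_eq] at hf
      have hpi : (Real.pi : ℂ) ≠ 0 := by exact_mod_cast Real.pi_ne_zero
      simpa [hpi] using hf
    have h1 : ‖𝓕 f (shellPoint ε 0 p) - 𝓕 f (shellPoint ε 0 0)‖
        ≤ B * ‖shellPoint ε 0 p - shellPoint ε 0 0‖ :=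
      convex_univ.norm_image_sub_le_of_norm_fderiv_le (𝕜 := ℝ)
        (fun x _ => (𝓕 f).differentiableAt)
        (fun x _ => by simpa [norm_iteratedFDeriv_one] using hB x) (Set.mem_univ _)
        (Set.mem_univ _)
    have h2 : ‖shellPoint ε 0 p - shellPoint ε 0 0‖ ≤ |p| := by
      refine abs_le_of_sq_le_sq' ?_ (abs_nonneg p) |>.2
      rw [EuclideanSpace.norm_sq_eq]
      simp only [shellPoint, hω, Fin.sum_univ_two, Real.norm_eq_abs, sq_abs, PiLp.sub_apply,
        Matrix.cons_val_zero, Matrix.cons_val_one, abs_zero]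
      have : (-(ε * |p| / (2 * Real.pi)) - -(ε * 0 / (2 * Real.pi))) ^ 2 +
          (ε * p / (2 * Real.pi) - ε * 0 / (2 * Real.pi)) ^ 2
          = ε ^ 2 * (|p| ^ 2 + p ^ 2) / (4 * Real.pi ^ 2) := by
        field_simp; ring
      rw [this, hε, sq_abs, div_le_iff₀ (by positivity)]
      nlinarith [sq_nonneg p, Real.pi_gt_three, mul_nonneg (sq_nonneg p) (sq_nonneg Real.pi),
        mul_le_mul_of_nonneg_left (show (1 : ℝ) ≤ Real.pi ^ 2 by
          nlinarith [Real.pi_gt_three]) (sq_nonneg p)]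
    rw [h0, sub_zero] at h1
    have hc : ‖(1 / (2 * Real.pi) : ℂ)‖ ≤ 1 := by
      have : (1 / (2 * Real.pi) : ℂ) = ((1 / (2 * Real.pi) : ℝ) : ℂ) := by push_cast; rfl
      rw [this, Complex.norm_real, Real.norm_of_nonneg (by positivity)]
      rw [div_le_one (by positivity)]
      linarith [Real.pi_gt_three]
    rw [massShell_eq, norm_mul]
    calc _ ≤ 1 * (B * ‖shellPoint ε 0 p - shellPoint ε 0 0‖) := by gcongr
      _ ≤ 1 * (B * |p|) := by gcongr
      _ = _ := one_mul _
  refine memLp_massShell_of_bound f (B * C) fun p => ?_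
  rw [hω]
  rcases eq_or_ne p 0 with rfl | hp
  · have hC0 : 0 ≤ C := by simpa using (norm_nonneg _).trans (hC 0)
    simp; positivity
  · have hp' : 0 < |p| := abs_pos.2 hp
    calc |p|⁻¹ * ‖massShell ε 0 f p‖ ^ 2
        = |p|⁻¹ * (‖massShell ε 0 f p‖ * ‖massShell ε 0 f p‖) := by ring
      _ ≤ |p|⁻¹ * ((B * |p|) * (C * (1 + p ^ 2)⁻¹)) := by
        gcongr
        · exact hlip p
        · exact hC p
      _ = _ := by field_simp

open Classical in
/-- `f^{m±}` as an element of the one-particle space `L²(ℝ, dp/ω_p^m)`. The function lies in this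
space for `m > 0` (`memLp_massShell_of_pos`), and for `m = 0` if `f^{0±}(0) = 0`
(`memLp_massShell_zero`); otherwise the value is `0` by convention. -/
def oneParticle (ε m : ℝ) (f : 𝓢(Spacetime, ℂ)) : Lp ℂ 2 (momentumMeasure m) :=
  if h : MemLp (massShell ε m f) 2 (momentumMeasure m) then h.toLp _ else 0

open Classical in
/-- `f_l(x) = l⁻² f(l⁻¹ x)` for `l > 0` (and `0` otherwise). -/
def rescale (l : ℝ) (f : 𝓢(Spacetime, ℂ)) : 𝓢(Spacetime, ℂ) :=
  if h : 0 < l then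
    ((l : ℂ) ^ 2)⁻¹ • SchwartzMap.compCLMOfContinuousLinearEquiv ℂ
      (ContinuousLinearEquiv.smulLeft (R₁ := ℝ) (M₁ := Spacetime) (Units.mk0 l h.ne')⁻¹) f
  else 0

theorem rescale_apply {l : ℝ} (hl : 0 < l) (f : 𝓢(Spacetime, ℂ)) (x : Spacetime) :
    rescale l f x = ((l : ℂ) ^ 2)⁻¹ * f (l⁻¹ • x) := by
  rw [rescale, dif_pos hl]
  rfl

/-- `f^j(x) = conj f(-x)`. -/
def reflect (f : 𝓢(Spacetime, ℂ)) : 𝓢(Spacetime, ℂ) :=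
  SchwartzMap.postcompCLM (𝕜 := ℝ) (Complex.conjCLE : ℂ →L[ℝ] ℂ)
    (SchwartzMap.compCLMOfContinuousLinearEquiv ℝ (ContinuousLinearEquiv.neg ℝ) f)

theorem reflect_apply (f : 𝓢(Spacetime, ℂ)) (x : Spacetime) :
    reflect f x = conj (f (-x)) := rfl


/-- The `n`-fold tensor power of `L²(ℝ, μ)`, realized as `L²(ℝⁿ, μⁿ)`. For `n = 0` the base is a
one-point space of mass `1`, so this is `ℂ`. -/
abbrev TensorPower (μ : Measure ℝ) (n : ℕ) : Type :=
  Lp ℂ 2 (Measure.pi fun _ : Fin n => μ)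

theorem measurePreserving_perm (μ : Measure ℝ) [SigmaFinite μ] {n : ℕ} (σ : Equiv.Perm (Fin n)) :
    MeasurePreserving (fun p : Fin n → ℝ => p ∘ σ)
      (Measure.pi fun _ : Fin n => μ) (Measure.pi fun _ : Fin n => μ) := by
  have h := measurePreserving_piCongrLeft (α := fun _ : Fin n => ℝ) (fun _ : Fin n => μ) σ.symm
  have e : ⇑(MeasurableEquiv.piCongrLeft (fun _ : Fin n => ℝ) σ.symm)
      = fun p : Fin n → ℝ => p ∘ σ := by
    funext p i
    have := Equiv.piCongrLeft_apply_apply (fun _ : Fin n => ℝ) σ.symm p (σ i)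
    simpa [MeasurableEquiv.coe_piCongrLeft] using this
  rw [e] at h
  exact h

theorem measurePreserving_cons (μ : Measure ℝ) [SigmaFinite μ] (n : ℕ) :
    MeasurePreserving (fun z : (Fin n → ℝ) × ℝ => (Fin.cons z.2 z.1 : Fin (n + 1) → ℝ))
      ((Measure.pi fun _ : Fin n => μ).prod μ) (Measure.pi fun _ : Fin (n + 1) => μ) := by
  have h := (measurePreserving_piFinSuccAbove (fun _ : Fin (n + 1) => μ) 0).symm
  have h2 := h.comp (Measure.measurePreserving_swap (μ := Measure.pi fun _ : Fin n => μ) (ν := μ))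
  convert h2 using 1
  funext z
  exact (Fin.insertNth_zero' z.2 z.1).symm

theorem ae_ae_cons {μ : Measure ℝ} [SigmaFinite μ] {n : ℕ} {P : (Fin (n + 1) → ℝ) → Prop}
    (h : ∀ᵐ p ∂(Measure.pi fun _ : Fin (n + 1) => μ), P p) :
    ∀ᵐ p ∂(Measure.pi fun _ : Fin n => μ), ∀ᵐ q ∂μ, P (Fin.cons q p) :=
  Measure.ae_ae_of_ae_prod ((measurePreserving_cons μ n).quasiMeasurePreserving.ae h)

/-- `(D_n(τ_j)Ψ)(p_1, …, p_n) = s(p_{j+1}, p_j) Ψ(p_1, …, p_{j+1}, p_j, …, p_n)`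
(positions counted from `0`). -/
def exchange (s : ℝ → ℝ → ℂ) {n : ℕ} (j : ℕ) (hj : j + 1 < n)
    (Ψ : (Fin n → ℝ) → ℂ) (p : Fin n → ℝ) : ℂ :=
  s (p ⟨j + 1, hj⟩) (p ⟨j, Nat.lt_of_succ_lt hj⟩) *
    Ψ (p ∘ Equiv.swap (⟨j, Nat.lt_of_succ_lt hj⟩ : Fin n) ⟨j + 1, hj⟩)

/-- The subspace of vectors invariant under all `D_n(τ_j)`. -/
def nParticle (μ : Measure ℝ) [SigmaFinite μ] (s : ℝ → ℝ → ℂ) (n : ℕ) :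
    Submodule ℂ (TensorPower μ n) where
  carrier := {Ψ | ∀ (j : ℕ) (hj : j + 1 < n),
    exchange s j hj Ψ =ᵐ[Measure.pi fun _ : Fin n => μ] Ψ}
  zero_mem' := by
    intro j hj
    have h0 := Lp.coeFn_zero ℂ 2 (Measure.pi fun _ : Fin n => μ)
    filter_upwards [h0, (measurePreserving_perm μ _).quasiMeasurePreserving.ae h0] with p h1 h2
    rw [exchange, h2, h1]; simp
  add_mem' := by
    intro a b ha hb j hj
    have h0 := Lp.coeFn_add a b
    filter_upwards [h0, (measurePreserving_perm μ _).quasiMeasurePreserving.ae h0,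
      ha j hj, hb j hj] with p h1 h2 h3 h4
    rw [exchange, h2, h1, Pi.add_apply, Pi.add_apply, ← h3, ← h4, exchange, exchange]; ring
  smul_mem' := by
    intro c a ha j hj
    have h0 := Lp.coeFn_smul c a
    filter_upwards [h0, (measurePreserving_perm μ _).quasiMeasurePreserving.ae h0,
      ha j hj] with p h1 h2 h3
    rw [exchange, h2, h1, Pi.smul_apply, Pi.smul_apply, ← h3, exchange, smul_eq_mul, smul_eq_mul]
    ring

theorem isClosed_nParticle (μ : Measure ℝ) [SigmaFinite μ] (s : ℝ → ℝ → ℂ) (n : ℕ) :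
    IsClosed (nParticle μ s n : Set (TensorPower μ n)) := by
  refine IsSeqClosed.isClosed fun u Ψ hu hΨ j hj => ?_
  obtain ⟨k, -, hk⟩ := (tendstoInMeasure_of_tendsto_Lp hΨ).exists_seq_tendsto_ae
  filter_upwards [hk, (measurePreserving_perm μ _).quasiMeasurePreserving.ae hk,
    ae_all_iff.2 fun i => hu (k i) j hj] with p h1 h2 h3
  refine tendsto_nhds_unique ?_ h1
  have : (fun i => (u (k i) : (Fin n → ℝ) → ℂ) p) = fun i => exchange s j hj (u (k i)) p := by
    funext i; exact (h3 i).symm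
  rw [this]
  exact h2.const_mul _

instance (μ : Measure ℝ) [SigmaFinite μ] (s : ℝ → ℝ → ℂ) (n : ℕ) :
    CompleteSpace (nParticle μ s n) :=
  (isClosed_nParticle μ s n).completeSpace_coe

theorem memLp_tensor {μ : Measure ℝ} [SigmaFinite μ] {n : ℕ} (φ : Lp ℂ 2 μ)
    (Ψ : TensorPower μ n) :
    MemLp (fun p : Fin (n + 1) → ℝ => φ (p 0) * Ψ (Fin.tail p)) 2
      (Measure.pi fun _ : Fin (n + 1) => μ) := by
  have hφ := Lp.memLp φ
  have hΨ := Lp.memLp Ψ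
  have h1 : MemLp (fun z : ℝ × (Fin n → ℝ) => φ z.1 * Ψ z.2) 2
      (μ.prod (Measure.pi fun _ : Fin n => μ)) := by
    have hm : AEStronglyMeasurable (fun z : ℝ × (Fin n → ℝ) => φ z.1 * Ψ z.2)
        (μ.prod (Measure.pi fun _ : Fin n => μ)) := hφ.1.comp_fst.mul hΨ.1.comp_snd
    rw [memLp_two_iff_integrable_sq_norm hm]
    have := ((memLp_two_iff_integrable_sq_norm hφ.1).1 hφ).mul_prod
      ((memLp_two_iff_integrable_sq_norm hΨ.1).1 hΨ)
    simpa [mul_pow] using this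
  exact h1.comp_measurePreserving
    (measurePreserving_piFinSuccAbove (fun _ : Fin (n + 1) => μ) 0)

/-- `Ψ ↦ φ ⊗ Ψ`. -/
def tensor {μ : Measure ℝ} [SigmaFinite μ] (n : ℕ) (φ : Lp ℂ 2 μ) :
    TensorPower μ n →ₗ[ℂ] TensorPower μ (n + 1) where
  toFun Ψ := (memLp_tensor φ Ψ).toLp _
  map_add' a b := by
    rw [← MemLp.toLp_add]
    refine MemLp.toLp_congr _ _ ?_
    have hq : Measure.QuasiMeasurePreserving (fun p : Fin (n + 1) → ℝ => Fin.tail p)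
        (Measure.pi fun _ : Fin (n + 1) => μ) (Measure.pi fun _ : Fin n => μ) :=
      Measure.quasiMeasurePreserving_snd.comp
        (measurePreserving_piFinSuccAbove (fun _ : Fin (n + 1) => μ) 0).quasiMeasurePreserving
    filter_upwards [hq.ae (Lp.coeFn_add a b)] with p hp
    rw [hp]; simp [mul_add]
  map_smul' c a := by
    rw [RingHom.id_apply, ← MemLp.toLp_const_smul]
    refine MemLp.toLp_congr _ _ ?_
    have hq : Measure.QuasiMeasurePreserving (fun p : Fin (n + 1) → ℝ => Fin.tail p)
        (Measure.pi fun _ : Fin (n + 1) => μ) (Measure.pi fun _ : Fin n => μ) :=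
      Measure.quasiMeasurePreserving_snd.comp
        (measurePreserving_piFinSuccAbove (fun _ : Fin (n + 1) => μ) 0).quasiMeasurePreserving
    filter_upwards [hq.ae (Lp.coeFn_smul c a)] with p hp
    rw [hp]; simp [mul_left_comm]

/-- `Ψ ↦ √(n+1) P_{n+1}(φ ⊗ Ψ)`, with `P_{n+1}` the orthogonal projection onto the
invariant subspace. -/
def create {μ : Measure ℝ} [SigmaFinite μ] (s : ℝ → ℝ → ℂ) (n : ℕ) (φ : Lp ℂ 2 μ) :
    nParticle μ s n →ₗ[ℂ] nParticle μ s (n + 1) :=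
  ((Real.sqrt (n + 1) : ℝ) : ℂ) •
    ((nParticle μ s (n + 1)).orthogonalProjectionOnto.toLinearMap ∘ₗ
      tensor n φ ∘ₗ (nParticle μ s n).subtype)

theorem ae_memLp_cons {μ : Measure ℝ} [SigmaFinite μ] {n : ℕ} (Ψ : TensorPower μ (n + 1)) :
    ∀ᵐ p ∂(Measure.pi fun _ : Fin n => μ), MemLp (fun q => Ψ (Fin.cons q p)) 2 μ := by
  have h1 := (Lp.memLp Ψ).comp_measurePreserving (measurePreserving_cons μ n)
  have h2 := ((memLp_two_iff_integrable_sq_norm h1.1).1 h1).prod_right_ae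
  filter_upwards [h1.1.prodMk_left, h2] with p h3 h4
  exact (memLp_two_iff_integrable_sq_norm h3).2 h4

/-- `p ↦ √(n+1) ∫ φ(q) Ψ(q, p_1, …, p_n) dμ(q)`. -/
def annihilateFun {μ : Measure ℝ} {n : ℕ} (φ : ℝ → ℂ) (Ψ : (Fin (n + 1) → ℝ) → ℂ)
    (p : Fin n → ℝ) : ℂ :=
  ((Real.sqrt (n + 1) : ℝ) : ℂ) * ∫ q, φ q * Ψ (Fin.cons q p) ∂μ

theorem memLp_annihilate {μ : Measure ℝ} [SigmaFinite μ] {n : ℕ} (φ : Lp ℂ 2 μ)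
    (Ψ : TensorPower μ (n + 1)) :
    MemLp (annihilateFun (μ := μ) φ Ψ) 2 (Measure.pi fun _ : Fin n => μ) := by
  have h1 := (Lp.memLp Ψ).comp_measurePreserving (measurePreserving_cons μ n)
  have hφ := Lp.memLp φ
  have hm : AEStronglyMeasurable (fun p : Fin n → ℝ => ∫ q, φ q * Ψ (Fin.cons q p) ∂μ)
      (Measure.pi fun _ : Fin n => μ) :=
    AEStronglyMeasurable.integral_prod_right' (f := fun z : (Fin n → ℝ) × ℝ =>
      φ z.2 * Ψ (Fin.cons z.2 z.1)) (hφ.1.comp_snd.mul h1.1)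
  refine MemLp.const_mul ?_ _
  rw [memLp_two_iff_integrable_sq_norm hm]
  have h2 := ((memLp_two_iff_integrable_sq_norm h1.1).1 h1).integral_prod_left
  refine (h2.const_mul (∫ q, ‖φ q‖ ^ 2 ∂μ)).mono' (hm.norm.pow 2) ?_
  filter_upwards [ae_memLp_cons Ψ] with p hp
  have hcs := integral_mul_norm_le_Lp_mul_Lq (μ := μ) (p := 2) (q := 2) (f := φ)
    (g := fun q => Ψ (Fin.cons q p)) Real.HolderConjugate.two_two
    (by simpa using hφ) (by simpa using hp)
  have hle : ‖∫ q, φ q * Ψ (Fin.cons q p) ∂μ‖ ≤ ∫ q, ‖φ q‖ * ‖Ψ (Fin.cons q p)‖ ∂μ := by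
    refine (norm_integral_le_integral_norm _).trans (le_of_eq ?_)
    simp
  have hA : 0 ≤ ∫ q, ‖φ q‖ ^ 2 ∂μ := integral_nonneg fun _ => by positivity
  have hB : 0 ≤ ∫ q, ‖Ψ (Fin.cons q p)‖ ^ 2 ∂μ := integral_nonneg fun _ => by positivity
  have h3 := hle.trans hcs
  simp only [Real.rpow_two, ← Real.sqrt_eq_rpow] at h3
  rw [Real.norm_of_nonneg (by positivity)]
  calc ‖∫ q, φ q * Ψ (Fin.cons q p) ∂μ‖ ^ 2
      ≤ (√(∫ q, ‖φ q‖ ^ 2 ∂μ) * √(∫ q, ‖Ψ (Fin.cons q p)‖ ^ 2 ∂μ)) ^ 2 := by gcongr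
    _ = _ := by rw [mul_pow, Real.sq_sqrt hA, Real.sq_sqrt hB]; rfl

/-- The annihilation map on `L²(ℝ^{n+1}) → L²(ℝ^n)`. -/
def annihilateTensor {μ : Measure ℝ} [SigmaFinite μ] (n : ℕ) (φ : Lp ℂ 2 μ) :
    TensorPower μ (n + 1) →ₗ[ℂ] TensorPower μ n where
  toFun Ψ := (memLp_annihilate φ Ψ).toLp _
  map_add' a b := by
    rw [← MemLp.toLp_add]
    refine MemLp.toLp_congr _ _ ?_
    filter_upwards [ae_ae_cons (Lp.coeFn_add a b),
      ae_memLp_cons a, ae_memLp_cons b]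
      with p h1 h2 h3
    have i2 : Integrable (fun q => φ q * a (Fin.cons q p)) μ :=
      MemLp.integrable_mul (Lp.memLp φ) h2
    have i3 : Integrable (fun q => φ q * b (Fin.cons q p)) μ :=
      MemLp.integrable_mul (Lp.memLp φ) h3
    rw [Pi.add_apply, annihilateFun, annihilateFun, annihilateFun, ← mul_add,
      ← integral_add i2 i3]
    congr 1
    refine integral_congr_ae ?_
    filter_upwards [h1] with q hq
    rw [← mul_add]
    exact congrArg _ hq
  map_smul' c a := by
    rw [RingHom.id_apply, ← MemLp.toLp_const_smul]
    refine MemLp.toLp_congr _ _ ?_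
    filter_upwards [ae_ae_cons (Lp.coeFn_smul c a)] with p h1
    rw [Pi.smul_apply, annihilateFun, annihilateFun, smul_eq_mul, mul_left_comm c,
      ← integral_const_mul c]
    congr 1
    refine integral_congr_ae ?_
    filter_upwards [h1] with q hq
    rw [mul_left_comm]
    exact congrArg _ hq

theorem annihilate_mem {μ : Measure ℝ} [SigmaFinite μ] {s : ℝ → ℝ → ℂ} {n : ℕ} (φ : Lp ℂ 2 μ)
    (Ψ : nParticle μ s (n + 1)) :
    annihilateTensor n φ Ψ ∈ nParticle μ s n := by
  intro j hj
  have h0 := (memLp_annihilate φ (Ψ : TensorPower μ (n + 1))).coeFn_toLp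
  have h1 := ae_ae_cons (Ψ.2 (j + 1) (by omega))
  filter_upwards [h0, (measurePreserving_perm μ _).quasiMeasurePreserving.ae h0, h1]
    with p h2 h3 h4
  change exchange s j hj ((memLp_annihilate φ (Ψ : TensorPower μ (n + 1))).toLp _) p
    = (memLp_annihilate φ (Ψ : TensorPower μ (n + 1))).toLp _ p
  rw [exchange, h3, h2, annihilateFun, annihilateFun, mul_left_comm, ← integral_const_mul]
  congr 1
  refine integral_congr_ae ?_
  filter_upwards [h4] with q hq
  rw [← hq, exchange, mul_left_comm]
  congr 3
  funext i
  refine Fin.cases ?_ (fun i => ?_) i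
  · have : Equiv.swap (⟨j + 1, by omega⟩ : Fin (n + 1)) ⟨j + 1 + 1, by omega⟩ 0 = 0 :=
      Equiv.swap_apply_of_ne_of_ne (by simp [Fin.ext_iff]) (by simp [Fin.ext_iff])
    simp [this]
  · have : Equiv.swap (⟨j + 1, by omega⟩ : Fin (n + 1)) ⟨j + 1 + 1, by omega⟩ i.succ
        = (Equiv.swap (⟨j, by omega⟩ : Fin n) ⟨j + 1, by omega⟩ i).succ :=
      (Fin.succ_injective n).swap_apply ⟨j, by omega⟩ ⟨j + 1, by omega⟩ i
    simp [this]

/-- `(z(φ)Ψ)_n(p) = √(n+1) ∫ φ(q) Ψ_{n+1}(q, p) dμ(q)`. -/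
def annihilate {μ : Measure ℝ} [SigmaFinite μ] (s : ℝ → ℝ → ℂ) (n : ℕ) (φ : Lp ℂ 2 μ) :
    nParticle μ s (n + 1) →ₗ[ℂ] nParticle μ s n :=
  (annihilateTensor n φ).restrict fun Ψ hΨ => annihilate_mem φ ⟨Ψ, hΨ⟩

/-- The `s`-symmetric Fock space, the Hilbert sum of the `n`-particle spaces. -/
abbrev Fock (μ : Measure ℝ) [SigmaFinite μ] (s : ℝ → ℝ → ℂ) : Type :=
  lp (fun n => nParticle μ s n) 2

/-- Vectors of finite particle number. -/
def finiteParticle (μ : Measure ℝ) [SigmaFinite μ] (s : ℝ → ℝ → ℂ) :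
    Submodule ℂ (Fock μ s) where
  carrier := {Ψ | ∃ N : ℕ, ∀ n, N ≤ n → Ψ n = 0}
  zero_mem' := ⟨0, fun _ _ => rfl⟩
  add_mem' := by
    rintro a b ⟨N, hN⟩ ⟨M, hM⟩
    refine ⟨max N M, fun n hn => ?_⟩
    rw [lp.coeFn_add, Pi.add_apply, hN n (le_trans (le_max_left _ _) hn),
      hM n (le_trans (le_max_right _ _) hn), add_zero]
  smul_mem' := by
    rintro c a ⟨N, hN⟩
    refine ⟨N, fun n hn => ?_⟩
    rw [lp.coeFn_smul, Pi.smul_apply, hN n hn, smul_zero]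

theorem memlp_of_eventually_zero {μ : Measure ℝ} [SigmaFinite μ] {s : ℝ → ℝ → ℂ}
    (Ψ : ∀ n, nParticle μ s n) (N : ℕ) (h : ∀ n, N ≤ n → Ψ n = 0) : Memℓp Ψ 2 := by
  refine (memℓp_zero ?_).of_exponent_ge zero_le
  refine (Set.finite_lt_nat N).subset fun n hn => ?_
  by_contra hc
  exact hn (h n (not_lt.1 hc))

/-- A finite sequence of `n`-particle vectors as a vector of finite particle number. -/
def mkFinite {μ : Measure ℝ} [SigmaFinite μ] {s : ℝ → ℝ → ℂ}
    (Ψ : ∀ n, nParticle μ s n) (h : ∃ N : ℕ, ∀ n, N ≤ n → Ψ n = 0) : finiteParticle μ s :=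
  ⟨⟨Ψ, memlp_of_eventually_zero Ψ h.choose h.choose_spec⟩, h⟩

/-- `z†(φ)` on vectors of finite particle number: `(z†(φ)Ψ)_n = √n P_n(φ ⊗ Ψ_{n-1})`. -/
def creation {μ : Measure ℝ} [SigmaFinite μ] (s : ℝ → ℝ → ℂ) (φ : Lp ℂ 2 μ) :
    Module.End ℂ (finiteParticle μ s) where
  toFun Ψ := mkFinite
    (fun n => match n with
      | 0 => 0
      | k + 1 => create s k φ ((Ψ : Fock μ s) k))
    (by
      obtain ⟨N, hN⟩ := Ψ.2
      refine ⟨N + 1, fun n hn => ?_⟩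
      obtain ⟨k, rfl⟩ : ∃ k, n = k + 1 := ⟨n - 1, by omega⟩
      change create s k φ _ = 0
      rw [hN k (by omega), map_zero])
  map_add' a b := by
    refine Subtype.ext (Subtype.ext (funext fun n => ?_))
    cases n with
    | zero => exact (add_zero _).symm
    | succ k => exact map_add (create s k φ) _ _
  map_smul' c a := by
    refine Subtype.ext (Subtype.ext (funext fun n => ?_))
    cases n with
    | zero => exact (smul_zero c).symm
    | succ k => exact map_smul (create s k φ) _ _

/-- `z(φ)` on vectors of finite particle number:
`(z(φ)Ψ)_n(p) = √(n+1) ∫ φ(q) Ψ_{n+1}(q, p) dμ(q)`. -/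
def annihilation {μ : Measure ℝ} [SigmaFinite μ] (s : ℝ → ℝ → ℂ) (φ : Lp ℂ 2 μ) :
    Module.End ℂ (finiteParticle μ s) where
  toFun Ψ := mkFinite (fun n => annihilate s n φ ((Ψ : Fock μ s) (n + 1)))
    (by
      obtain ⟨N, hN⟩ := Ψ.2
      refine ⟨N, fun n hn => ?_⟩
      rw [hN (n + 1) (by omega), map_zero])
  map_add' a b :=
    Subtype.ext (Subtype.ext (funext fun n => map_add (annihilate s n φ) _ _))
  map_smul' c a :=
    Subtype.ext (Subtype.ext (funext fun n => map_smul (annihilate s n φ) _ _))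


theorem memLp_one (μ : Measure ℝ) [SigmaFinite μ] :
    MemLp (fun _ : Fin 0 → ℝ => (1 : ℂ)) 2 (Measure.pi fun _ : Fin 0 => μ) := by
  have : IsFiniteMeasure (Measure.pi fun _ : Fin 0 => μ) := by
    rw [Measure.pi_of_empty]; infer_instance
  exact memLp_const 1

/-- `Ω = 1 ⊕ 0 ⊕ 0 ⊕ …`. -/
def vacuum (μ : Measure ℝ) [SigmaFinite μ] (s : ℝ → ℝ → ℂ) : finiteParticle μ s :=
  mkFinite
    (fun n => match n with
      | 0 => ⟨(memLp_one μ).toLp _, fun _ hj => absurd hj (Nat.not_lt_zero _)⟩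
      | _ + 1 => 0)
    ⟨1, fun n hn => by
      obtain ⟨k, rfl⟩ : ∃ k, n = k + 1 := ⟨n - 1, by omega⟩
      rfl⟩

theorem memLp_reverse {μ : Measure ℝ} [SigmaFinite μ] {n : ℕ} (Ψ : TensorPower μ n) :
    MemLp (fun p : Fin n → ℝ => conj (Ψ (p ∘ Fin.revPerm))) 2
      (Measure.pi fun _ : Fin n => μ) :=
  ((Lp.memLp Ψ).comp_measurePreserving (measurePreserving_perm μ Fin.revPerm)).star

/-- `(p_1, …, p_n) ↦ conj Ψ(p_n, …, p_1)`. -/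
def reverseTensor {μ : Measure ℝ} [SigmaFinite μ] (n : ℕ) :
    TensorPower μ n →ₗ⋆[ℂ] TensorPower μ n where
  toFun Ψ := (memLp_reverse Ψ).toLp _
  map_add' a b := by
    rw [← MemLp.toLp_add]
    refine MemLp.toLp_congr _ _ ?_
    filter_upwards [(measurePreserving_perm μ Fin.revPerm).quasiMeasurePreserving.ae
      (Lp.coeFn_add a b)] with p hp
    rw [hp]; simp
  map_smul' c a := by
    rw [← MemLp.toLp_const_smul]
    refine MemLp.toLp_congr _ _ ?_
    filter_upwards [(measurePreserving_perm μ Fin.revPerm).quasiMeasurePreserving.ae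
      (Lp.coeFn_smul c a)] with p hp
    rw [hp]; simp

theorem reverse_mem {μ : Measure ℝ} [SigmaFinite μ] {s : ℝ → ℝ → ℂ}
    (hs : ∀ p q, s p q * conj (s p q) = 1) {n : ℕ} (Ψ : nParticle μ s n) :
    reverseTensor n (Ψ : TensorPower μ n) ∈ nParticle μ s n := by
  intro j hj
  have h0 := (memLp_reverse (Ψ : TensorPower μ n)).coeFn_toLp
  have h1 := (measurePreserving_perm μ
    (Equiv.swap (⟨j, Nat.lt_of_succ_lt hj⟩ : Fin n) ⟨j + 1, hj⟩)).quasiMeasurePreserving.ae h0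
  have hk : n - (j + 2) + 1 < n := by omega
  have h2 := (measurePreserving_perm μ
    (Equiv.swap (⟨j, Nat.lt_of_succ_lt hj⟩ : Fin n) ⟨j + 1, hj⟩)).quasiMeasurePreserving.ae
    ((measurePreserving_perm μ Fin.revPerm).quasiMeasurePreserving.ae (Ψ.2 (n - (j + 2)) hk))
  filter_upwards [h0, h1, h2] with p h4 h5 h6
  have r0 : Fin.rev (⟨n - (j + 2), Nat.lt_of_succ_lt hk⟩ : Fin n) = ⟨j + 1, hj⟩ := by
    ext; simp [Fin.rev]; omega
  have r1 : Fin.rev (⟨n - (j + 2) + 1, hk⟩ : Fin n) = ⟨j, Nat.lt_of_succ_lt hj⟩ := by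
    ext; simp [Fin.rev]; omega
  have e : ((p ∘ Equiv.swap (⟨j, Nat.lt_of_succ_lt hj⟩ : Fin n) ⟨j + 1, hj⟩) ∘ Fin.revPerm) ∘
      Equiv.swap (⟨n - (j + 2), Nat.lt_of_succ_lt hk⟩ : Fin n) ⟨n - (j + 2) + 1, hk⟩
      = p ∘ Fin.revPerm := by
    funext i
    have h7 := Fin.rev_injective.swap_apply (⟨n - (j + 2), Nat.lt_of_succ_lt hk⟩ : Fin n)
      ⟨n - (j + 2) + 1, hk⟩ i
    rw [r0, r1, Equiv.swap_comm] at h7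
    simp only [Function.comp_apply, Fin.revPerm_apply, ← h7, Equiv.swap_apply_self]
  rw [exchange, e] at h6
  simp only [Function.comp_apply, Fin.revPerm_apply, r0, r1, Equiv.swap_apply_left,
    Equiv.swap_apply_right] at h6
  change exchange s j hj ((memLp_reverse (Ψ : TensorPower μ n)).toLp _) p
    = (memLp_reverse (Ψ : TensorPower μ n)).toLp _ p
  rw [exchange, h5, h4, ← h6, map_mul, ← mul_assoc, hs, one_mul]

theorem reverse_reverse {μ : Measure ℝ} [SigmaFinite μ] {n : ℕ} (Ψ : TensorPower μ n) :
    reverseTensor n (reverseTensor n Ψ) = Ψ := by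
  refine Lp.ext ?_
  have h0 := (memLp_reverse Ψ).coeFn_toLp
  filter_upwards [(memLp_reverse (reverseTensor n Ψ)).coeFn_toLp,
    (measurePreserving_perm μ Fin.revPerm).quasiMeasurePreserving.ae h0] with p h1 h2
  refine h1.trans ?_
  change conj ((memLp_reverse Ψ).toLp _ (p ∘ Fin.revPerm)) = _
  rw [h2, Complex.conj_conj]
  congr 1
  funext i
  simp

/-- The antilinear involution `(U(j)Ψ)_n(p_1, …, p_n) = conj Ψ_n(p_n, …, p_1)`
on the vectors of finite particle number. -/
def reflection {μ : Measure ℝ} [SigmaFinite μ] {s : ℝ → ℝ → ℂ}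
    (hs : ∀ p q, s p q * conj (s p q) = 1) :
    finiteParticle μ s ≃ₗ⋆[ℂ] finiteParticle μ s :=
  LinearEquiv.ofInvolutive
    { toFun := fun Ψ => mkFinite
        (fun n => ⟨reverseTensor n ((Ψ : Fock μ s) n).1, reverse_mem hs ((Ψ : Fock μ s) n)⟩)
        (by
          obtain ⟨N, hN⟩ := Ψ.2
          refine ⟨N, fun n hn => Subtype.ext ?_⟩
          change reverseTensor n ((Ψ : Fock μ s) n).1 = 0
          rw [hN n hn]
          exact map_zero _)
      map_add' := fun a b => Subtype.ext (Subtype.ext (funext fun n =>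
        Subtype.ext (map_add (reverseTensor n) _ _)))
      map_smul' := fun c a => Subtype.ext (Subtype.ext (funext fun n =>
        Subtype.ext (map_smulₛₗ (reverseTensor n) c _))) }
    (fun Ψ => Subtype.ext (Subtype.ext (funext fun n =>
      Subtype.ext (reverse_reverse ((Ψ : Fock μ s) n).1))))

/-- The field `φ_m(f) = z†_m(f^{m+}) + z_m(f^{m-})` on vectors of finite particle number. -/
def field (S : ℂ → ℂ) (m : ℝ) (f : 𝓢(Spacetime, ℂ)) :
    Module.End ℂ (finiteParticle (momentumMeasure m) (kernel S m)) :=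
  creation (kernel S m) (oneParticle 1 m f) + annihilation (kernel S m) (oneParticle (-1) m f)

/-- The reflected field `φ_m'(f) = U_m(j) φ_m(f^j) U_m(j)⁻¹`. -/
def reflectedField {S : ℂ → ℂ} (hS : IsScatteringFunctionWithLimit S) (m : ℝ)
    (f : 𝓢(Spacetime, ℂ)) :
    Module.End ℂ (finiteParticle (momentumMeasure m) (kernel S m)) :=
  (reflection (kernel_unitary hS m)).toLinearMap ∘ₛₗ field S m (reflect f) ∘ₛₗ
    (reflection (kernel_unitary hS m)).symm.toLinearMap

/-- `⟨Ω, A_1 ⋯ A_n Ω⟩`. -/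
def vacuumExpectation {μ : Measure ℝ} [SigmaFinite μ] {s : ℝ → ℝ → ℂ} {n : ℕ}
    (A : Fin n → Module.End ℂ (finiteParticle μ s)) : ℂ :=
  inner ℂ (vacuum μ s : Fock μ s) ((List.ofFn A).prod (vacuum μ s) : Fock μ s)

/-- `⟨Ω_m, φ_m(f_{1,l}) ⋯ φ_m(f_{n,l}) Ω_m⟩`. -/
def nPoint (S : ℂ → ℂ) (m l : ℝ) {n : ℕ} (f : Fin n → 𝓢(Spacetime, ℂ)) : ℂ :=
  vacuumExpectation fun j => field S m (rescale l (f j))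

/-- `⟨Ω_m, φ_m'(f_{1,l}) ⋯ φ_m'(f_{n,l}) Ω_m⟩`. -/
def reflectedNPoint {S : ℂ → ℂ} (hS : IsScatteringFunctionWithLimit S) (m l : ℝ) {n : ℕ}
    (f : Fin n → 𝓢(Spacetime, ℂ)) : ℂ :=
  vacuumExpectation fun j => reflectedField hS m (rescale l (f j))

end

end FactorizingModel

namespace FactorizingModel

noncomputable section

/-! ### The creation operator as an explicit sum -/

/-! Rescaling the test functions by λ at fixed mass m amounts to keeping them fixed and replacing m
by λm. Indeed f_λ on the mass shell m is f on the mass shell λm at momentum λp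
(`massShell_rescale`), the measure dp/ω and the two-particle kernel are invariant under (m, p) ↦
(λm, λp), and the vacuum expectation value carries no free momentum (`stateFun_rescale`). The
assertion is therefore continuity of the n-point function in the mass at m = 0.

The Hilbert spaces vary with m, so the limit is taken on explicit functions. The projection in the
creation operator is evaluated as a finite sum over the position of the new particle
(`create_ae_eq`). Every component of φ(f_1) ⋯ φ(f_k)Ω is then represented by a function on ℝⁿ built
from f^{m±}, the kernel and one-variable integrals (`stateFun`). The n-point function is its value
in the zero-particle sector (`nPoint_eq_stateFun`).

Pointwise convergence is an induction on the number of fields (`tendsto_stateFun`). It rests on two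
facts.

The kernels converge away from zero momenta (`tendsto_kernel`). Rapidity differences converge for
momenta of equal sign and tend to ±∞ for opposite signs. In the latter case S(∞) = S(-∞) is needed,
which follows from crossing symmetry and Cauchy's theorem (`tendsto_limitValue_atBot`).

The integrals are dominated uniformly in the mass. Since f^{0±}(0) = 0, the Fourier transform
vanishes at the origin, so |f^{m±}| is at most a constant times ω and also at most a constant times
1/(1+p²). The geometric mean gives |f^{m±}|² ≤ C²ω/(1+p²) (`norm_massShell_le`), and the factor ω
cancels the infrared singularity of dp/ω.

For the reflected field, U(j) fixes Ω and acts on the zero-particle sector as complex conjugation,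
so its n-point functions are conjugates of those of the field with test functions f^j. -/

/-- The function `φ ⊗ Ψ` with the first variable moved to position `k`, together with the factors
`s(p_k, p_l)`, `l < k`, picked up on the way. -/
def insertTerm (s : ℝ → ℝ → ℂ) (φ : ℝ → ℂ) {n : ℕ} (Ψ : (Fin n → ℝ) → ℂ) (k : Fin (n + 1))
    (p : Fin (n + 1) → ℝ) : ℂ :=
  (∏ l ∈ Finset.Iio k, s (p k) (p l)) * (φ (p k) * Ψ (k.removeNth p))

/-- The explicit form of `√(n+1) P_{n+1}(φ ⊗ Ψ)` for an `s`-symmetric function `Ψ`. -/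
def createFun (s : ℝ → ℝ → ℂ) (φ : ℝ → ℂ) {n : ℕ} (Ψ : (Fin n → ℝ) → ℂ)
    (p : Fin (n + 1) → ℝ) : ℂ :=
  ((Real.sqrt (n + 1) : ℝ) : ℂ)⁻¹ * ∑ k, insertTerm s φ Ψ k p

theorem comp_cycleRange_symm_zero {n : ℕ} (k : Fin (n + 1)) (p : Fin (n + 1) → ℝ) :
    (p ∘ k.cycleRange.symm) 0 = p k := by
  simp

theorem tail_comp_cycleRange_symm {n : ℕ} (k : Fin (n + 1)) (p : Fin (n + 1) → ℝ) :
    Fin.tail (p ∘ k.cycleRange.symm) = k.removeNth p := by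
  funext i
  simp [Fin.tail, Fin.removeNth]

/-- The permutation `k.cycleRange.symm` lists the positions as k, 0, 1, … with k omitted afterwards.
Passing from k to k+1 just exchanges the entries k and k+1, which is the inductive step of
`ae_eq_move_to_front`. -/
theorem swap_cycleRange_symm {n : ℕ} (i : Fin n) (j : Fin (n + 1)) :
    Equiv.swap i.castSucc i.succ (i.castSucc.cycleRange.symm j) = i.succ.cycleRange.symm j := by
  refine Fin.cases ?_ (fun j => ?_) j
  · simp
  · rw [Fin.cycleRange_symm_succ, Fin.cycleRange_symm_succ]
    simp only [Fin.succAbove, Equiv.swap_apply_def, Fin.ext_iff, Fin.lt_def]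
    split_ifs <;> simp_all <;> omega

theorem norm_eq_one_of_unitary {s : ℝ → ℝ → ℂ} (hs : ∀ p q, s p q * conj (s p q) = 1) (p q : ℝ) :
    ‖s p q‖ = 1 := by
  have h := hs p q
  rw [Complex.mul_conj, Complex.normSq_eq_norm_sq] at h
  have h2 : ‖s p q‖ ^ 2 = 1 := by exact_mod_cast h
  nlinarith [norm_nonneg (s p q)]

theorem norm_prod_eq_one {s : ℝ → ℝ → ℂ} (hs : ∀ p q, s p q * conj (s p q) = 1) {n : ℕ}
    (k : Fin n) (p : Fin n → ℝ) : ‖∏ l ∈ Finset.Iio k, s (p k) (p l)‖ = 1 := by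
  rw [norm_prod]
  exact Finset.prod_eq_one fun l _ => norm_eq_one_of_unitary hs _ _

/-- An `s`-symmetric function is determined by moving the `k`-th variable to the front. -/
theorem ae_eq_move_to_front {μ : Measure ℝ} [SigmaFinite μ] {s : ℝ → ℝ → ℂ} {n : ℕ}
    (Φ : nParticle μ s (n + 1)) (k : Fin (n + 1)) :
    ∀ᵐ p ∂(Measure.pi fun _ : Fin (n + 1) => μ), (Φ : TensorPower μ (n + 1)) p =
      (∏ l ∈ Finset.Iio k, s (p k) (p l)) *
        (Φ : TensorPower μ (n + 1)) (p ∘ k.cycleRange.symm) := by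
  refine Fin.induction ?_ (fun i ih => ?_) k
  · refine Eventually.of_forall fun p => ?_
    have : Finset.Iio (0 : Fin (n + 1)) = ∅ := by ext; simp
    have e : p ∘ (0 : Fin (n + 1)).cycleRange.symm = p := by
      rw [Fin.cycleRange_zero]; rfl
    rw [this, Finset.prod_empty, one_mul, e]
  -- One exchange of i and i+1 contributes the new factor. The induction hypothesis is then used at
  -- the permuted point, which is allowed almost everywhere because permutations preserve the
  -- product measure.
  · have h := Φ.2 i (by omega)
    have h' := (measurePreserving_perm μ
      (Equiv.swap i.castSucc i.succ)).quasiMeasurePreserving.ae ih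
    filter_upwards [h, h'] with p h1 h2
    have e : (p ∘ Equiv.swap i.castSucc i.succ) ∘ i.castSucc.cycleRange.symm
        = p ∘ i.succ.cycleRange.symm := by
      funext j
      simp only [Function.comp_apply, swap_cycleRange_symm]
    have hI : Finset.Iio i.succ = insert i.castSucc (Finset.Iio i.castSucc) := by
      ext j
      simp only [Finset.mem_Iio, Finset.mem_insert, Fin.lt_def, Fin.ext_iff, Fin.val_succ,
        Fin.val_castSucc]
      omega
    rw [e] at h2
    refine h1.symm.trans ?_
    change s (p i.succ) (p i.castSucc) *
      (Φ : TensorPower μ (n + 1)) (p ∘ Equiv.swap i.castSucc i.succ) = _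
    rw [h2, hI, Finset.prod_insert (by simp), mul_assoc, ← mul_assoc]
    rw [← mul_assoc]
    congr 2
    refine Finset.prod_congr rfl fun l hl => ?_
    have hl' : l < i.castSucc := by simpa using hl
    have hls : l < i.succ := hl'.trans Fin.castSucc_lt_succ
    simp only [Function.comp_apply, Equiv.swap_apply_left,
      Equiv.swap_apply_of_ne_of_ne hl'.ne hls.ne]

/-- Two neighbouring positions remain neighbours after a third one is deleted, so an exchange not
involving k is again an elementary exchange of the remaining variables. -/
theorem swap_comp_succAbove {n : ℕ} {j : ℕ} (hj : j + 1 < n + 1) (k : Fin (n + 1))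
    (h0 : k.val ≠ j) (h1 : k.val ≠ j + 1) :
    ∃ (i : ℕ) (hi : i + 1 < n),
      k.succAbove ⟨i, Nat.lt_of_succ_lt hi⟩ = ⟨j, Nat.lt_of_succ_lt hj⟩ ∧
      k.succAbove ⟨i + 1, hi⟩ = ⟨j + 1, hj⟩ := by
  rcases lt_or_gt_of_ne h0 with h | h
  · refine ⟨j - 1, by omega, ?_, ?_⟩ <;>
    · simp only [Fin.succAbove, Fin.ext_iff, Fin.lt_def]
      split_ifs <;> simp_all <;> omega
  · refine ⟨j, by omega, ?_, ?_⟩ <;>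
    · simp only [Fin.succAbove, Fin.ext_iff, Fin.lt_def]
      split_ifs <;> simp_all <;> omega

/-- The exchange permutes the summands of `createFun`, which makes their sum symmetric. For k = j
the extra factor s(p_{j+1}, p_j) extends the product by one term. For k = j+1 it cancels one term by
s(p,q)s(q,p) = 1. Otherwise both exchanged variables sit in Ψ, whose symmetry absorbs the factor.
Symmetry of Ψ is required only at the points that occur, so that an almost-everywhere identity
suffices. -/
theorem insertTerm_swap {s : ℝ → ℝ → ℂ} (hs : ∀ p q, s p q * s q p = 1) (φ : ℝ → ℂ) {n : ℕ}
    (Ψ : (Fin n → ℝ) → ℂ) (p : Fin (n + 1) → ℝ)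
    (hΨ : ∀ (k : Fin (n + 1)) (i : ℕ) (hi : i + 1 < n),
      exchange s i hi Ψ (k.removeNth p) = Ψ (k.removeNth p))
    (j : ℕ) (hj : j + 1 < n + 1) (k : Fin (n + 1)) :
    exchange s j hj (insertTerm s φ Ψ k) p = insertTerm s φ Ψ
      (Equiv.swap (⟨j, Nat.lt_of_succ_lt hj⟩ : Fin (n + 1)) ⟨j + 1, hj⟩ k) p := by
  set a : Fin (n + 1) := ⟨j, Nat.lt_of_succ_lt hj⟩ with ha
  set b : Fin (n + 1) := ⟨j + 1, hj⟩ with hb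
  have hab : a < b := by simp [ha, hb]
  have hIb : Finset.Iio b = insert a (Finset.Iio a) := by
    ext l
    simp only [Finset.mem_Iio, Finset.mem_insert, Fin.lt_def, Fin.ext_iff, ha, hb]
    omega
  have hfix : ∀ l < a, Equiv.swap a b l = l := fun l hl =>
    Equiv.swap_apply_of_ne_of_ne hl.ne (hl.trans hab).ne
  have hrem : b.removeNth (p ∘ Equiv.swap a b) = a.removeNth p ∧
      a.removeNth (p ∘ Equiv.swap a b) = b.removeNth p := by
    constructor <;>
    · funext i
      simp only [Fin.removeNth, Function.comp_apply]
      congr 1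
      simp only [Fin.succAbove, Equiv.swap_apply_def, Fin.ext_iff, Fin.lt_def, ha, hb]
      split_ifs <;> simp_all <;> omega
  rw [exchange]
  change s (p b) (p a) * insertTerm s φ Ψ k (p ∘ Equiv.swap a b) = _
  by_cases hka : k = a
  · subst hka
    rw [Equiv.swap_apply_left]
    simp only [insertTerm, Function.comp_apply, Equiv.swap_apply_left]
    rw [hrem.2, hIb, Finset.prod_insert (by simp), ← mul_assoc]
    congr 2
    refine Finset.prod_congr rfl fun l hl => ?_
    rw [hfix l (by simpa using hl)]
  by_cases hkb : k = b
  · subst hkb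
    rw [Equiv.swap_apply_right]
    simp only [insertTerm, Function.comp_apply, Equiv.swap_apply_right]
    rw [hrem.1, hIb, Finset.prod_insert (by simp), Equiv.swap_apply_left, ← mul_assoc,
      ← mul_assoc (s (p b) (p a)), hs, one_mul]
    congr 1
    refine Finset.prod_congr rfl fun l hl => ?_
    rw [hfix l (by simpa using hl)]
  · have hk : Equiv.swap a b k = k := Equiv.swap_apply_of_ne_of_ne hka hkb
    obtain ⟨i, hi, e0, e1⟩ := swap_comp_succAbove hj k
      (fun h => hka (Fin.ext h)) (fun h => hkb (Fin.ext h))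
    have hr : k.removeNth (p ∘ Equiv.swap a b) = k.removeNth p ∘
        Equiv.swap (⟨i, Nat.lt_of_succ_lt hi⟩ : Fin n) ⟨i + 1, hi⟩ := by
      funext l
      simp only [Fin.removeNth, Function.comp_apply]
      congr 1
      rw [← Fin.succAbove_right_injective.swap_apply, e0, e1]
    have h := hΨ k i hi
    rw [exchange, ← hr] at h
    have f0 : k.removeNth p ⟨i, Nat.lt_of_succ_lt hi⟩ = p a := congrArg p e0
    have f1 : k.removeNth p ⟨i + 1, hi⟩ = p b := congrArg p e1
    rw [f0, f1] at h
    have hprod : ∏ l ∈ Finset.Iio k, s (p k) (p (Equiv.swap a b l))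
        = ∏ l ∈ Finset.Iio k, s (p k) (p l) := by
      refine Finset.prod_equiv (Equiv.swap a b) (fun l => ?_) (fun l _ => rfl)
      have hka' : k.val ≠ j := fun h => hka (Fin.ext h)
      have hkb' : k.val ≠ j + 1 := fun h => hkb (Fin.ext h)
      simp only [Finset.mem_Iio, Equiv.swap_apply_def, Fin.lt_def, Fin.ext_iff, ha, hb]
      split_ifs <;> simp_all <;> omega
    simp only [insertTerm, Function.comp_apply, hk, hprod]
    rw [← h]
    ring

theorem quasiMeasurePreserving_removeNth (μ : Measure ℝ) [SigmaFinite μ] {n : ℕ}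
    (k : Fin (n + 1)) :
    Measure.QuasiMeasurePreserving (fun p : Fin (n + 1) → ℝ => k.removeNth p)
      (Measure.pi fun _ : Fin (n + 1) => μ) (Measure.pi fun _ : Fin n => μ) :=
  Measure.quasiMeasurePreserving_snd.comp
    (measurePreserving_piFinSuccAbove (fun _ : Fin (n + 1) => μ) k).quasiMeasurePreserving

theorem quasiMeasurePreserving_apply (μ : Measure ℝ) [SigmaFinite μ] {n : ℕ}
    (k : Fin (n + 1)) :
    Measure.QuasiMeasurePreserving (fun p : Fin (n + 1) → ℝ => p k)
      (Measure.pi fun _ : Fin (n + 1) => μ) μ :=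
  Measure.quasiMeasurePreserving_fst.comp
    (measurePreserving_piFinSuccAbove (fun _ : Fin (n + 1) => μ) k).quasiMeasurePreserving

theorem exchange_createFun_ae {μ : Measure ℝ} [SigmaFinite μ] {s : ℝ → ℝ → ℂ}
    (hs : ∀ p q, s p q * s q p = 1) (φ : ℝ → ℂ) {n : ℕ} (Ψ : nParticle μ s n)
    (j : ℕ) (hj : j + 1 < n + 1) :
    exchange s j hj (createFun s φ (Ψ : TensorPower μ n)) =ᵐ[Measure.pi fun _ => μ]
      createFun s φ (Ψ : TensorPower μ n) := by
  have h : ∀ᵐ p ∂(Measure.pi fun _ : Fin (n + 1) => μ), ∀ (k : Fin (n + 1)) (i : Fin n)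
      (hi : i.val + 1 < n), exchange s i hi (Ψ : TensorPower μ n) (k.removeNth p)
        = (Ψ : TensorPower μ n) (k.removeNth p) := by
    simp only [ae_all_iff]
    exact fun k i hi => (quasiMeasurePreserving_removeNth μ k).ae (Ψ.2 i hi)
  filter_upwards [h] with p hp
  rw [exchange, createFun, createFun, mul_left_comm, Finset.mul_sum]
  congr 1
  rw [← Equiv.sum_comp
    (Equiv.swap (⟨j, Nat.lt_of_succ_lt hj⟩ : Fin (n + 1)) ⟨j + 1, hj⟩)
    (fun k => insertTerm s φ (Ψ : TensorPower μ n) k p)]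
  refine Finset.sum_congr rfl fun k _ => ?_
  exact insertTerm_swap hs φ _ p (fun k i hi => hp k ⟨i, by omega⟩ hi) j hj k

theorem measurable_prod_kernel {s : ℝ → ℝ → ℂ} (hm : Measurable (Function.uncurry s)) {n : ℕ}
    (k : Fin n) : Measurable fun p : Fin n → ℝ => ∏ l ∈ Finset.Iio k, s (p k) (p l) := by
  refine Finset.measurable_fun_prod _ fun l _ => ?_
  exact Measurable.comp (g := Function.uncurry s) (f := fun p : Fin n → ℝ => (p k, p l)) hm
    ((measurable_pi_apply k).prodMk (measurable_pi_apply l))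

/-- Up to a factor of modulus one, this is φ ⊗ Ψ composed with a permutation of the variables. -/
theorem memLp_insertTerm {μ : Measure ℝ} [SigmaFinite μ] {s : ℝ → ℝ → ℂ}
    (hs : ∀ p q, s p q * conj (s p q) = 1) (hm : Measurable (Function.uncurry s)) {n : ℕ}
    (φ : Lp ℂ 2 μ) (Ψ : TensorPower μ n) (k : Fin (n + 1)) :
    MemLp (insertTerm s φ Ψ k) 2 (Measure.pi fun _ : Fin (n + 1) => μ) := by
  have h := (memLp_tensor φ Ψ).comp_measurePreserving
    (measurePreserving_perm μ k.cycleRange.symm)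
  have e : (fun p : Fin (n + 1) → ℝ => φ (p 0) * Ψ (Fin.tail p)) ∘
      (fun p : Fin (n + 1) → ℝ => p ∘ k.cycleRange.symm)
      = fun p => φ (p k) * Ψ (k.removeNth p) := by
    funext p
    simp only [Function.comp_def, Fin.cycleRange_symm_zero]
    rw [← tail_comp_cycleRange_symm]
    rfl
  rw [e] at h
  refine h.of_le ((measurable_prod_kernel hm k).aestronglyMeasurable.mul h.1) ?_
  refine Eventually.of_forall fun p => ?_
  rw [insertTerm, norm_mul, norm_prod_eq_one hs, one_mul]

theorem memLp_createFun {μ : Measure ℝ} [SigmaFinite μ] {s : ℝ → ℝ → ℂ}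
    (hs : ∀ p q, s p q * conj (s p q) = 1) (hm : Measurable (Function.uncurry s)) {n : ℕ}
    (φ : Lp ℂ 2 μ) (Ψ : TensorPower μ n) :
    MemLp (createFun s φ Ψ) 2 (Measure.pi fun _ : Fin (n + 1) => μ) :=
  (memLp_finsetSum _ fun k _ => memLp_insertTerm hs hm φ Ψ k).const_mul _

/-- Moving the k-th variable of the symmetric Φ to the front produces the same phase as in the
inserted term. Paired with its conjugate the phase cancels, and a permutation of variables does the
rest. Hence all summands have the same inner product with Φ. -/
theorem integral_conj_mul_insertTerm {μ : Measure ℝ} [SigmaFinite μ] {s : ℝ → ℝ → ℂ}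
    (hs : ∀ p q, s p q * conj (s p q) = 1) {n : ℕ} (φ : ℝ → ℂ) (Ψ : (Fin n → ℝ) → ℂ)
    (Φ : nParticle μ s (n + 1)) (k : Fin (n + 1)) :
    ∫ p, conj ((Φ : TensorPower μ (n + 1)) p) * insertTerm s φ Ψ k p
        ∂(Measure.pi fun _ : Fin (n + 1) => μ)
      = ∫ p, conj ((Φ : TensorPower μ (n + 1)) p) * (φ (p 0) * Ψ (Fin.tail p))
        ∂(Measure.pi fun _ : Fin (n + 1) => μ) := by
  have e := measurePreserving_piCongrLeft (α := fun _ : Fin (n + 1) => ℝ)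
    (fun _ : Fin (n + 1) => μ) k.cycleRange
  have ee : ⇑(MeasurableEquiv.piCongrLeft (fun _ : Fin (n + 1) => ℝ) k.cycleRange)
      = fun p : Fin (n + 1) → ℝ => p ∘ k.cycleRange.symm := by
    funext p i
    have := Equiv.piCongrLeft_apply_apply (fun _ : Fin (n + 1) => ℝ) k.cycleRange p
      (k.cycleRange.symm i)
    simpa [MeasurableEquiv.coe_piCongrLeft] using this
  rw [← e.integral_comp (MeasurableEquiv.measurableEmbedding _) (fun p =>
    conj ((Φ : TensorPower μ (n + 1)) p) * (φ (p 0) * Ψ (Fin.tail p))), ee]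
  refine integral_congr_ae ?_
  filter_upwards [ae_eq_move_to_front Φ k] with p hp
  rw [hp, insertTerm, comp_cycleRange_symm_zero, tail_comp_cycleRange_symm, map_mul]
  have h1 : (∏ l ∈ Finset.Iio k, s (p k) (p l)) *
      conj (∏ l ∈ Finset.Iio k, s (p k) (p l)) = 1 := by
    rw [map_prod, ← Finset.prod_mul_distrib]
    exact Finset.prod_eq_one fun l _ => hs _ _
  linear_combination (conj ((Φ : TensorPower μ (n + 1)) (p ∘ k.cycleRange.symm)) *
    (φ (p k) * Ψ (k.removeNth p))) * h1

/-- The orthogonal projection is identified by its characterization: the explicit sum lies in the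
symmetric subspace, and its difference from √(n+1) φ ⊗ Ψ is orthogonal to that subspace. -/
theorem create_ae_eq {μ : Measure ℝ} [SigmaFinite μ] {s : ℝ → ℝ → ℂ}
    (hs : ∀ p q, s p q * conj (s p q) = 1) (hs' : ∀ p q, s p q * s q p = 1)
    (hm : Measurable (Function.uncurry s)) {n : ℕ} (φ : Lp ℂ 2 μ) (Ψ : nParticle μ s n) :
    ((create s n φ Ψ : nParticle μ s (n + 1)) : TensorPower μ (n + 1))
      =ᵐ[Measure.pi fun _ : Fin (n + 1) => μ] createFun s φ (Ψ : TensorPower μ n) := by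
  have hML := memLp_createFun hs hm φ (Ψ : TensorPower μ n)
  set c : ℂ := ((Real.sqrt (n + 1) : ℝ) : ℂ) with hc
  have hcc : c * c = (n : ℂ) + 1 := by
    rw [hc, ← Complex.ofReal_mul, Real.mul_self_sqrt (by positivity)]
    push_cast; rfl
  have hc0 : c ≠ 0 := by
    intro h
    rw [h, mul_zero] at hcc
    exact Nat.cast_add_one_ne_zero n hcc.symm
  have hcoe := hML.coeFn_toLp
  have hmem : hML.toLp _ ∈ nParticle μ s (n + 1) := by
    intro j hj
    filter_upwards [hcoe, (measurePreserving_perm μ _).quasiMeasurePreserving.ae hcoe,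
      exchange_createFun_ae hs' φ Ψ j hj] with p h1 h2 h3
    rw [exchange, h2, h1, ← h3, exchange]
  have hproj : (nParticle μ s (n + 1)).starProjection (c • tensor n φ (Ψ : TensorPower μ n))
      = hML.toLp _ := by
    refine Submodule.eq_starProjection_of_mem_of_inner_eq_zero hmem fun w hw => ?_
    rw [← inner_conj_symm, map_eq_zero, inner_sub_right, inner_smul_right, sub_eq_zero,
      L2.inner_def, L2.inner_def]
    have hT := (memLp_tensor φ (Ψ : TensorPower μ n)).coeFn_toLp
    have e1 : ∫ p, inner ℂ (w p) (tensor n φ (Ψ : TensorPower μ n) p)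
          ∂(Measure.pi fun _ : Fin (n + 1) => μ)
        = ∫ p, conj (w p) * (φ (p 0) * (Ψ : TensorPower μ n) (Fin.tail p))
          ∂(Measure.pi fun _ : Fin (n + 1) => μ) := by
      refine integral_congr_ae ?_
      filter_upwards [hT] with p hp
      rw [RCLike.inner_apply', ← hp]
      rfl
    have e2 : ∫ p, inner ℂ (w p) (hML.toLp _ p) ∂(Measure.pi fun _ : Fin (n + 1) => μ)
        = ∫ p, c⁻¹ * ∑ k, conj (w p) * insertTerm s φ (Ψ : TensorPower μ n) k p
          ∂(Measure.pi fun _ : Fin (n + 1) => μ) := by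
      refine integral_congr_ae ?_
      filter_upwards [hcoe] with p hp
      rw [RCLike.inner_apply', hp, createFun, ← Finset.mul_sum, mul_left_comm]
    have hint : ∀ k ∈ Finset.univ, Integrable
        (fun p => conj (w p) * insertTerm s φ (Ψ : TensorPower μ n) k p)
        (Measure.pi fun _ : Fin (n + 1) => μ) := fun k _ =>
      MemLp.integrable_mul (Lp.memLp w).star (memLp_insertTerm hs hm φ _ k)
    rw [e1, e2, integral_const_mul, integral_finsetSum _ hint]
    -- The n+1 inner products coincide, and c⁻¹(n+1) = c because c² = n+1.
    rw [Finset.sum_congr rfl fun k _ =>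
      integral_conj_mul_insertTerm hs φ (Ψ : TensorPower μ n) ⟨w, hw⟩ k]
    rw [Finset.sum_const, Finset.card_univ, Fintype.card_fin, nsmul_eq_mul]
    push_cast
    rw [← hcc]
    field_simp
  have h : ((create s n φ Ψ : nParticle μ s (n + 1)) : TensorPower μ (n + 1)) = hML.toLp _ := by
    rw [← hproj, map_smul]
    rfl
  rw [h]
  exact hcoe

/-! ### Vacuum expectation values in terms of explicit functions -/

theorem createFun_congr_ae {μ : Measure ℝ} [SigmaFinite μ] (s : ℝ → ℝ → ℂ) {φ φ' : ℝ → ℂ} {n : ℕ}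
    {Ψ Ψ' : (Fin n → ℝ) → ℂ} (hφ : φ =ᵐ[μ] φ') (hΨ : Ψ =ᵐ[Measure.pi fun _ => μ] Ψ') :
    createFun s φ Ψ =ᵐ[Measure.pi fun _ => μ] createFun s φ' Ψ' := by
  have h1 : ∀ᵐ p ∂(Measure.pi fun _ : Fin (n + 1) => μ), ∀ k : Fin (n + 1), φ (p k) = φ' (p k) :=
    ae_all_iff.2 fun k => (quasiMeasurePreserving_apply μ k).ae hφ
  have h2 : ∀ᵐ p ∂(Measure.pi fun _ : Fin (n + 1) => μ), ∀ k : Fin (n + 1),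
      Ψ (k.removeNth p) = Ψ' (k.removeNth p) :=
    ae_all_iff.2 fun k => (quasiMeasurePreserving_removeNth μ k).ae hΨ
  filter_upwards [h1, h2] with p h3 h4
  simp only [createFun, insertTerm, h3, h4]

theorem annihilateFun_congr_ae {μ : Measure ℝ} [SigmaFinite μ] {φ φ' : ℝ → ℂ} {n : ℕ}
    {Ψ Ψ' : (Fin (n + 1) → ℝ) → ℂ} (hφ : φ =ᵐ[μ] φ') (hΨ : Ψ =ᵐ[Measure.pi fun _ => μ] Ψ') :
    annihilateFun (μ := μ) φ Ψ =ᵐ[Measure.pi fun _ => μ] annihilateFun (μ := μ) φ' Ψ' := by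
  filter_upwards [ae_ae_cons hΨ] with p hp
  rw [annihilateFun, annihilateFun]
  congr 1
  refine integral_congr_ae ?_
  filter_upwards [hφ, hp] with q h1 h2
  rw [h1, h2]

/-- The creation part of `fieldFun`. -/
def creationFun (s : ℝ → ℝ → ℂ) (φ : ℝ → ℂ) (F : ∀ n, (Fin n → ℝ) → ℂ) :
    ∀ n, (Fin n → ℝ) → ℂ
  | 0 => 0
  | k + 1 => createFun s φ (F k)

/-- The action of `φ_m(f)` on sequences of functions. -/
def fieldFun (S : ℂ → ℂ) (m : ℝ) (f : 𝓢(Spacetime, ℂ)) (F : ∀ n, (Fin n → ℝ) → ℂ) (n : ℕ)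
    (p : Fin n → ℝ) : ℂ :=
  creationFun (kernel S m) (massShell 1 m f) F n p +
    annihilateFun (μ := momentumMeasure m) (massShell (-1) m f) (F (n + 1)) p

/-- The sequence of functions `(1, 0, 0, …)` representing the vacuum. -/
def vacuumFun (n : ℕ) (_ : Fin n → ℝ) : ℂ := if n = 0 then 1 else 0

/-- The functions representing the components of `φ_m(f_1) ⋯ φ_m(f_k) Ω`. -/
def stateFun (S : ℂ → ℂ) (m : ℝ) (fs : List 𝓢(Spacetime, ℂ)) : ∀ n, (Fin n → ℝ) → ℂ :=
  fs.foldr (fieldFun S m) vacuumFun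

theorem oneParticle_ae_eq {ε m : ℝ} {f : 𝓢(Spacetime, ℂ)}
    (h : MemLp (massShell ε m f) 2 (momentumMeasure m)) :
    oneParticle ε m f =ᵐ[momentumMeasure m] massShell ε m f := by
  rw [oneParticle, dif_pos h]
  exact h.coeFn_toLp

theorem vacuum_ae_eq (μ : Measure ℝ) [SigmaFinite μ] (s : ℝ → ℝ → ℂ) (n : ℕ) :
    (((vacuum μ s : Fock μ s) n : nParticle μ s n) : TensorPower μ n)
      =ᵐ[Measure.pi fun _ => μ] vacuumFun n := by
  cases n with
  | zero => exact (memLp_one μ).coeFn_toLp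
  | succ n => exact Lp.coeFn_zero ℂ 2 _

/-- Square integrability is essential here: without it `oneParticle` would be 0 by convention
instead of representing `massShell`. -/
theorem field_ae_eq {S : ℂ → ℂ} {m : ℝ} (hs : ∀ p q, kernel S m p q * conj (kernel S m p q) = 1)
    (hs' : ∀ p q, kernel S m p q * kernel S m q p = 1)
    (hm : Measurable (Function.uncurry (kernel S m))) {f : 𝓢(Spacetime, ℂ)}
    (h1 : MemLp (massShell 1 m f) 2 (momentumMeasure m))
    (h2 : MemLp (massShell (-1) m f) 2 (momentumMeasure m))
    {X : finiteParticle (momentumMeasure m) (kernel S m)} {F : ∀ n, (Fin n → ℝ) → ℂ}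
    (hX : ∀ n, (((X : Fock (momentumMeasure m) (kernel S m)) n : nParticle _ _ n) :
      TensorPower (momentumMeasure m) n) =ᵐ[Measure.pi fun _ => momentumMeasure m] F n) (n : ℕ) :
    (((field S m f X : Fock (momentumMeasure m) (kernel S m)) n : nParticle _ _ n) :
      TensorPower (momentumMeasure m) n)
      =ᵐ[Measure.pi fun _ => momentumMeasure m] fieldFun S m f F n := by
  have ha : ((annihilate (kernel S m) n (oneParticle (-1) m f)
      ((X : Fock (momentumMeasure m) (kernel S m)) (n + 1)) : nParticle _ _ n) :
      TensorPower (momentumMeasure m) n) =ᵐ[Measure.pi fun _ => momentumMeasure m]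
      annihilateFun (μ := momentumMeasure m) (massShell (-1) m f) (F (n + 1)) :=
    (memLp_annihilate _ _).coeFn_toLp.trans
      (annihilateFun_congr_ae (oneParticle_ae_eq h2) (hX (n + 1)))
  cases n with
  | zero =>
    refine (Lp.coeFn_add (0 : TensorPower (momentumMeasure m) 0) _).trans ?_
    filter_upwards [Lp.coeFn_zero ℂ 2 (Measure.pi fun _ : Fin 0 => momentumMeasure m), ha]
      with p h3 h4
    exact congrArg₂ (· + ·) h3 h4
  | succ k =>
    have hc := (create_ae_eq hs hs' hm (oneParticle 1 m f)
      ((X : Fock (momentumMeasure m) (kernel S m)) k)).trans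
      (createFun_congr_ae (kernel S m) (oneParticle_ae_eq h1) (hX k))
    refine (Lp.coeFn_add (create (kernel S m) k (oneParticle 1 m f)
      ((X : Fock (momentumMeasure m) (kernel S m)) k)).1 _).trans ?_
    filter_upwards [hc, ha] with p h3 h4
    exact congrArg₂ (· + ·) h3 h4

/-- This replaces L² classes, which live in spaces depending on m, by actual functions on ℝⁿ whose
values for different masses can be compared. -/
theorem prod_field_vacuum_ae_eq {S : ℂ → ℂ} {m : ℝ}
    (hs : ∀ p q, kernel S m p q * conj (kernel S m p q) = 1)
    (hs' : ∀ p q, kernel S m p q * kernel S m q p = 1)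
    (hm : Measurable (Function.uncurry (kernel S m))) (fs : List 𝓢(Spacetime, ℂ))
    (h : ∀ f ∈ fs, MemLp (massShell 1 m f) 2 (momentumMeasure m) ∧
      MemLp (massShell (-1) m f) 2 (momentumMeasure m)) (n : ℕ) :
    ((((fs.map (field S m)).prod (vacuum _ _) : Fock (momentumMeasure m) (kernel S m)) n :
      nParticle _ _ n) : TensorPower (momentumMeasure m) n)
      =ᵐ[Measure.pi fun _ => momentumMeasure m] stateFun S m fs n := by
  induction fs generalizing n with
  | nil => exact vacuum_ae_eq _ _ n
  | cons f fs ih =>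
    have hf := h f List.mem_cons_self
    rw [List.map_cons, List.prod_cons]
    exact field_ae_eq hs hs' hm hf.1 hf.2
      (ih fun g hg => h g (List.mem_cons_of_mem f hg)) n

theorem inner_vacuum {μ : Measure ℝ} [SigmaFinite μ] {s : ℝ → ℝ → ℂ} (X : Fock μ s) :
    inner ℂ (vacuum μ s : Fock μ s) X
      = ∫ p, ((X 0 : nParticle μ s 0) : TensorPower μ 0) p
        ∂(Measure.pi fun _ : Fin 0 => μ) := by
  rw [lp.inner_eq_tsum, tsum_eq_single 0]
  · rw [Submodule.coe_inner, L2.inner_def]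
    refine integral_congr_ae ?_
    filter_upwards [vacuum_ae_eq μ s 0] with p hp
    rw [hp, vacuumFun, if_pos rfl]
    simp
  · intro n hn
    obtain ⟨k, rfl⟩ := Nat.exists_eq_succ_of_ne_zero hn
    exact inner_zero_left _

theorem integral_pi_fin_zero (μ : Measure ℝ) [SigmaFinite μ] (F : (Fin 0 → ℝ) → ℂ) :
    ∫ p, F p ∂(Measure.pi fun _ : Fin 0 => μ) = F ![] := by
  rw [Measure.pi_of_empty _ ![]]
  exact integral_dirac _ _

/-- The vacuum sees only the zero-particle component, and the zero-particle measure is a point mass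
at the empty tuple, so the inner product is an evaluation. -/
theorem nPoint_eq_stateFun {S : ℂ → ℂ} {m : ℝ}
    (hs : ∀ p q, kernel S m p q * conj (kernel S m p q) = 1)
    (hs' : ∀ p q, kernel S m p q * kernel S m q p = 1)
    (hm : Measurable (Function.uncurry (kernel S m))) (l : ℝ) {n : ℕ}
    (f : Fin n → 𝓢(Spacetime, ℂ))
    (h : ∀ j, MemLp (massShell 1 m (rescale l (f j))) 2 (momentumMeasure m) ∧
      MemLp (massShell (-1) m (rescale l (f j))) 2 (momentumMeasure m)) :
    nPoint S m l f = stateFun S m (List.ofFn fun j => rescale l (f j)) 0 ![] := by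
  have e : (List.ofFn fun j => field S m (rescale l (f j)))
      = (List.ofFn fun j => rescale l (f j)).map (field S m) := by
    rw [List.map_ofFn]; rfl
  rw [nPoint, vacuumExpectation, inner_vacuum, e,
    ← integral_pi_fin_zero (momentumMeasure m) (stateFun S m _ 0)]
  refine integral_congr_ae (prod_field_vacuum_ae_eq hs hs' hm _ (fun g hg => ?_) 0)
  obtain ⟨j, rfl⟩ := (List.mem_ofFn' _ _).1 hg
  exact h j

/-! ### Reduction of the reflected field to the field. -/

theorem reflection_symm_vacuum {μ : Measure ℝ} [SigmaFinite μ] {s : ℝ → ℝ → ℂ}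
    (hs : ∀ p q, s p q * conj (s p q) = 1) :
    (reflection hs).symm (vacuum μ s) = vacuum μ s := by
  rw [LinearEquiv.symm_apply_eq]
  refine Subtype.ext (Subtype.ext (funext fun n => Subtype.ext ?_))
  cases n with
  | zero =>
    refine Lp.ext ?_
    have h := vacuum_ae_eq μ s 0
    refine h.trans ?_
    filter_upwards [(memLp_reverse ((vacuum μ s : Fock μ s) 0).1).coeFn_toLp,
      (measurePreserving_perm μ Fin.revPerm).quasiMeasurePreserving.ae h] with p h1 h2
    refine Eq.trans ?_ h1.symm
    rw [h2]
    simp [vacuumFun]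
  | succ n => exact (map_zero (reverseTensor (μ := μ) (n + 1))).symm

theorem inner_vacuum_reflection {μ : Measure ℝ} [SigmaFinite μ] {s : ℝ → ℝ → ℂ}
    (hs : ∀ p q, s p q * conj (s p q) = 1) (X : finiteParticle μ s) :
    inner ℂ (vacuum μ s : Fock μ s) (reflection hs X : Fock μ s)
      = conj (inner ℂ (vacuum μ s : Fock μ s) (X : Fock μ s)) := by
  rw [inner_vacuum, inner_vacuum, ← integral_conj]
  refine integral_congr_ae ?_
  filter_upwards [(memLp_reverse ((X : Fock μ s) 0).1).coeFn_toLp] with p h1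
  refine h1.trans ?_
  rw [Subsingleton.elim (p ∘ Fin.revPerm) p]

/-- Between consecutive factors U⁻¹ meets U, so the conjugations telescope to a single outer one. -/
theorem prod_reflectedField {S : ℂ → ℂ} (hS : IsScatteringFunctionWithLimit S) (m : ℝ)
    (fs : List 𝓢(Spacetime, ℂ)) (X : finiteParticle (momentumMeasure m) (kernel S m)) :
    (fs.map (reflectedField hS m)).prod X = reflection (kernel_unitary hS m)
      ((fs.map fun f => field S m (reflect f)).prod
        ((reflection (kernel_unitary hS m)).symm X)) := by
  induction fs with
  | nil => simp
  | cons f fs ih =>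
    rw [List.map_cons, List.prod_cons, Module.End.mul_apply, ih, List.map_cons, List.prod_cons,
      Module.End.mul_apply]
    simp [reflectedField]

/-- The outer U⁻¹ fixes Ω, and the outer U conjugates the zero-particle component. -/
theorem reflectedNPoint_eq {S : ℂ → ℂ} (hS : IsScatteringFunctionWithLimit S) (m l : ℝ) {n : ℕ}
    (f : Fin n → 𝓢(Spacetime, ℂ)) (h : ∀ j, reflect (rescale l (f j)) = rescale l (reflect (f j))) :
    reflectedNPoint hS m l f = conj (nPoint S m l fun j => reflect (f j)) := by
  have e : (List.ofFn fun j => reflectedField hS m (rescale l (f j)))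
      = (List.ofFn fun j => rescale l (f j)).map (reflectedField hS m) := by
    rw [List.map_ofFn]; rfl
  rw [reflectedNPoint, vacuumExpectation, e, prod_reflectedField, reflection_symm_vacuum,
    inner_vacuum_reflection, List.map_ofFn]
  simp only [Function.comp_def, h]
  rfl

theorem reflect_rescale {l : ℝ} (hl : 0 < l) (f : 𝓢(Spacetime, ℂ)) :
    reflect (rescale l f) = rescale l (reflect f) := by
  ext x
  rw [reflect_apply, rescale_apply hl, rescale_apply hl, reflect_apply, map_mul, smul_neg]
  simp

theorem rescale_one (f : 𝓢(Spacetime, ℂ)) : rescale 1 f = f := by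
  ext x
  simp [rescale_apply one_pos]

/-- At zero mass and momentum the exponential is 1, so the condition reads ∫ f = 0 for either sign;
this is stable under f ↦ f^j. -/
theorem massShell_reflect_zero {ε : ℝ} {f : 𝓢(Spacetime, ℂ)} (hf : massShell ε 0 f 0 = 0) :
    massShell ε 0 (reflect f) 0 = 0 := by
  have hpi : (Real.pi : ℂ) ≠ 0 := by exact_mod_cast Real.pi_ne_zero
  have e : ∀ g : 𝓢(Spacetime, ℂ), massShell ε 0 g 0 = 0 ↔ ∫ x, g x = 0 := by
    intro g
    simp [massShell, energy, hpi]
  rw [e] at hf ⊢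
  simp only [reflect_apply]
  rw [integral_conj, integral_neg_eq_self (fun x => f x), hf, map_zero]

/-! ### The two-particle scattering kernels -/

theorem continuous_scattering {S : ℂ → ℂ} (hS : IsScatteringFunction S) :
    Continuous fun θ : ℝ => S θ :=
  hS.continuousOn.comp_continuous Complex.continuous_ofReal fun θ => by
    simp [closedStrip, Real.pi_pos.le]

theorem scattering_conj {S : ℂ → ℂ} (hS : IsScatteringFunction S) (θ : ℝ) :
    conj (S θ) = S ((-θ : ℝ) : ℂ) := by
  rw [hS.conj_eq_inv, hS.inv_eq_crossing, hS.crossing_eq_neg, Complex.ofReal_neg]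

theorem scattering_mul_neg {S : ℂ → ℂ} (hS : IsScatteringFunction S) (θ : ℝ) :
    S θ * S ((-θ : ℝ) : ℂ) = 1 := by
  rw [← scattering_conj hS, hS.conj_eq_inv, mul_inv_cancel₀ (hS.ne_zero θ)]

/-- By Cauchy's theorem, the boundary values of a bounded analytic function on the two edges of
the strip have nearby integrals over large intervals. -/
theorem norm_integral_sub_crossing_le {S : ℂ → ℂ} (hS : IsScatteringFunction S) {C : ℝ}
    (hC : ∀ ζ ∈ closedStrip 0 Real.pi, ‖S ζ‖ ≤ C) (R : ℝ) :
    ‖∫ θ in R..2 * R, (S θ - S ((-θ : ℝ) : ℂ))‖ ≤ 2 * (C * Real.pi) := by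
  have hpi := Real.pi_pos
  -- The contour is the boundary of [R, 2R] × [0, π]. By crossing, the upper edge carries S(-θ), and
  -- the two vertical sides have length π whatever R is.
  have hrect := Complex.integral_boundary_rect_eq_zero_of_continuousOn_of_differentiableOn S
    (R : ℂ) ((2 * R : ℝ) + Real.pi * Complex.I)
    (hS.continuousOn.mono fun z hz => by
      simp only [Complex.mem_reProdIm, Complex.add_im, Complex.ofReal_im, Complex.mul_im,
        Complex.ofReal_re, Complex.I_im, Complex.I_re, mul_one, mul_zero, add_zero, zero_add,
        Set.uIcc_of_le hpi.le] at hz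
      exact hz.2)
    (hS.analytic.mono fun z hz => by
      simp only [Complex.mem_reProdIm, Complex.add_im, Complex.ofReal_im, Complex.mul_im,
        Complex.ofReal_re, Complex.I_im, Complex.I_re, mul_one, mul_zero, add_zero, zero_add,
        min_eq_left hpi.le, max_eq_right hpi.le] at hz
      exact hz.2)
  simp only [Complex.add_im, Complex.ofReal_im, Complex.mul_im, Complex.ofReal_re, Complex.I_im,
    Complex.I_re, mul_one, mul_zero, add_zero, zero_add, Complex.add_re, Complex.mul_re, sub_self,
    Complex.ofReal_zero, zero_mul] at hrect
  have hcross : ∀ θ : ℝ, S (θ + Real.pi * Complex.I) = S ((-θ : ℝ) : ℂ) := fun θ => by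
    rw [mul_comm, hS.crossing_eq_neg, Complex.ofReal_neg]
  simp only [hcross] at hrect
  have hc := continuous_scattering hS
  have hc' : Continuous fun θ : ℝ => S ((-θ : ℝ) : ℂ) := hc.comp continuous_neg
  rw [intervalIntegral.integral_sub (hc.intervalIntegrable _ _) (hc'.intervalIntegrable _ _)]
  have hside : ∀ x : ℝ, ‖∫ y in (0 : ℝ)..Real.pi, S (x + y * Complex.I)‖ ≤ C * Real.pi := by
    intro x
    have := intervalIntegral.norm_integral_le_of_norm_le_const (a := (0 : ℝ)) (b := Real.pi)
      (f := fun y : ℝ => S (x + y * Complex.I)) (C := C) (fun y hy => hC _ (by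
        rw [Set.uIoc_of_le hpi.le] at hy
        simpa [closedStrip] using ⟨hy.1.le, hy.2⟩))
    simpa [abs_of_pos hpi] using this
  have h1 := hside (2 * R)
  have h2 := hside R
  set A := ∫ y in (0 : ℝ)..Real.pi, S ((2 * R : ℝ) + y * Complex.I)
  set B := ∫ y in (0 : ℝ)..Real.pi, S (R + y * Complex.I)
  have e : (∫ θ in R..2 * R, S θ) - ∫ θ in R..2 * R, S ((-θ : ℝ) : ℂ)
      = Complex.I • B - Complex.I • A := by
    linear_combination hrect
  rw [e]
  refine (norm_sub_le _ _).trans ?_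
  rw [norm_smul, norm_smul, Complex.norm_I, one_mul, one_mul]
  linarith

/-- An integral over [R, 2R] of a function tending to d behaves like Rd, which is unbounded unless d
= 0. -/
theorem limit_eq_zero_of_integral_bounded {g : ℝ → ℂ} (hg : Continuous g) {d : ℂ}
    (hd : Tendsto g atTop (𝓝 d)) {K : ℝ}
    (hK : ∀ R : ℝ, 0 < R → ‖∫ θ in R..2 * R, g θ‖ ≤ K) : d = 0 := by
  by_contra hne
  have hpos : 0 < ‖d‖ := norm_pos_iff.2 hne
  obtain ⟨N, hN⟩ := (Metric.tendsto_atTop.1 hd) (‖d‖ / 2) (by positivity)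
  -- Beyond N the integral has norm at least R‖d‖/2, and the last entry makes this at least K + 1.
  set R := max (max N 1) (2 * (K + 1) / ‖d‖) with hRdef
  have hR1 : 1 ≤ R := (le_max_right _ _).trans (le_max_left _ _)
  have hRN : N ≤ R := (le_max_left _ _).trans (le_max_left _ _)
  have hRK : 2 * (K + 1) / ‖d‖ ≤ R := le_max_right _ _
  have hR0 : 0 < R := by linarith
  have h1 : ‖∫ θ in R..2 * R, (g θ - d)‖ ≤ ‖d‖ / 2 * |2 * R - R| := by
    refine intervalIntegral.norm_integral_le_of_norm_le_const fun θ hθ => ?_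
    rw [Set.uIoc_of_le (by linarith)] at hθ
    have := hN θ (hRN.trans hθ.1.le)
    rw [dist_eq_norm] at this
    exact this.le
  rw [intervalIntegral.integral_sub (hg.intervalIntegrable _ _) intervalIntegrable_const,
    intervalIntegral.integral_const, show 2 * R - R = R by ring, abs_of_pos hR0] at h1
  have h2 := hK R hR0
  have h3 : ‖R • d‖ = R * ‖d‖ := by rw [norm_smul, Real.norm_of_nonneg hR0.le]
  have h4 := norm_sub_norm_le (R • d) (∫ θ in R..2 * R, g θ)
  rw [norm_sub_rev] at h4
  rw [div_le_iff₀ hpos] at hRK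
  nlinarith

theorem tendsto_limitValue_atTop {S : ℂ → ℂ} (hS : IsScatteringFunctionWithLimit S) :
    Tendsto (fun θ : ℝ => S θ) atTop (𝓝 (limitValue S)) :=
  tendsto_nhds_limUnder hS.limit_atTop

/-- The limits of a scattering function at `∞` and `-∞` agree. -/
theorem tendsto_limitValue_atBot {S : ℂ → ℂ} (hS : IsScatteringFunctionWithLimit S) :
    Tendsto (fun θ : ℝ => S θ) atBot (𝓝 (limitValue S)) := by
  obtain ⟨b, hb⟩ := hS.limit_atBot
  obtain ⟨C, hC⟩ := hS.bounded
  have hS' := hS.toIsScatteringFunction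
  have hc := continuous_scattering hS'
  have ht := (tendsto_limitValue_atTop hS).sub (hb.comp tendsto_neg_atTop_atBot)
  -- Applied to θ ↦ S(θ) - S(-θ), whose limit is S(∞) - S(-∞).
  have h := limit_eq_zero_of_integral_bounded (hc.sub (hc.comp continuous_neg)) ht
    (fun R _ => norm_integral_sub_crossing_le hS' hC R)
  rw [sub_eq_zero.1 h]
  exact hb

theorem limitValue_mul_self {S : ℂ → ℂ} (hS : IsScatteringFunctionWithLimit S) :
    limitValue S * limitValue S = 1 := by
  have h := (tendsto_limitValue_atTop hS).mul
    ((tendsto_limitValue_atBot hS).comp tendsto_neg_atTop_atBot)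
  refine tendsto_nhds_unique h (tendsto_const_nhds.congr fun θ => ?_)
  exact (scattering_mul_neg hS.toIsScatteringFunction θ).symm

theorem kernel_zero (S : ℂ → ℂ) : kernel S 0 = masslessKernel S := if_pos rfl

theorem kernel_of_ne_zero (S : ℂ → ℂ) {m : ℝ} (hm : m ≠ 0) : kernel S m = massiveKernel S m :=
  if_neg hm

theorem kernel_mul_swap {S : ℂ → ℂ} (hS : IsScatteringFunctionWithLimit S) (m p q : ℝ) :
    kernel S m p q * kernel S m q p = 1 := by
  have h := scattering_mul_neg hS.toIsScatteringFunction
  by_cases hm : m = 0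
  · subst hm
    rw [kernel_zero, masslessKernel, masslessKernel]
    by_cases h1 : 0 < p ∧ 0 < q
    · rw [if_pos h1, if_pos h1.symm, ← neg_sub (Real.log p), h]
    rw [if_neg h1, if_neg (fun h : 0 < q ∧ 0 < p => h1 h.symm)]
    by_cases h2 : p < 0 ∧ q < 0
    · rw [if_pos h2, if_pos h2.symm, ← neg_sub (Real.log (-q)), h]
    rw [if_neg h2, if_neg (fun h : q < 0 ∧ p < 0 => h2 h.symm)]
    by_cases h3 : p = 0 ∧ q = 0
    · rw [if_pos h3, if_pos h3.symm]
      simpa using h 0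
    -- In the remaining case both orders of the arguments give S(∞), so S(∞)² = 1 is what is needed.
    rw [if_neg h3, if_neg (fun h : q = 0 ∧ p = 0 => h3 h.symm), limitValue_mul_self hS]
  · rw [kernel_of_ne_zero S hm, massiveKernel, massiveKernel,
      ← neg_sub (p * energy m q) (q * energy m p), neg_div, Real.arsinh_neg, h]

theorem measurable_kernel {S : ℂ → ℂ} (hS : IsScatteringFunctionWithLimit S) (m : ℝ) :
    Measurable (Function.uncurry (kernel S m)) := by
  have hc := (continuous_scattering hS.toIsScatteringFunction).measurable
  by_cases hm : m = 0
  · subst hm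
    rw [kernel_zero]
    refine Measurable.ite ?_ (hc.comp (by fun_prop)) (Measurable.ite ?_ (hc.comp (by fun_prop))
      (Measurable.ite ?_ measurable_const measurable_const))
    · exact (measurableSet_lt measurable_const measurable_fst).inter
        (measurableSet_lt measurable_const measurable_snd)
    · exact (measurableSet_lt measurable_fst measurable_const).inter
        (measurableSet_lt measurable_snd measurable_const)
    · exact (measurableSet_eq_fun measurable_fst measurable_const).inter
        (measurableSet_eq_fun measurable_snd measurable_const)
  · rw [kernel_of_ne_zero S hm]
    have he : Continuous (energy m) := by unfold energy; fun_prop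
    refine hc.comp (f := fun z : ℝ × ℝ =>
      Real.arsinh ((z.1 * energy m z.2 - z.2 * energy m z.1) / m ^ 2)) ?_
    refine (Real.continuous_arsinh.comp ?_).measurable
    fun_prop

/-! ### Scale invariance and massless limit of the kernels. -/

theorem energy_mul {l : ℝ} (hl : 0 < l) (m p : ℝ) : energy (l * m) (l * p) = l * energy m p := by
  rw [energy, energy, show (l * p) ^ 2 + (l * m) ^ 2 = l ^ 2 * (p ^ 2 + m ^ 2) by ring,
    Real.sqrt_mul (by positivity), Real.sqrt_sq hl.le]

theorem kernel_mul {l : ℝ} (hl : 0 < l) (S : ℂ → ℂ) {m : ℝ} (hm : m ≠ 0) (p q : ℝ) :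
    kernel S (l * m) (l * p) (l * q) = kernel S m p q := by
  rw [kernel_of_ne_zero S hm, kernel_of_ne_zero S (mul_ne_zero hl.ne' hm), massiveKernel,
    massiveKernel, energy_mul hl, energy_mul hl]
  congr 3
  have := hl.ne'
  field_simp

/-- With p = m sinh θ and ω_p = m cosh θ, the argument of arsinh is sinh(θ_p - θ_q) by the addition
theorem. -/
theorem arsinh_rapidity {m : ℝ} (hm : 0 < m) (p q : ℝ) :
    Real.arsinh ((p * energy m q - q * energy m p) / m ^ 2)
      = Real.arsinh (p / m) - Real.arsinh (q / m) := by
  have h : ∀ x, √(1 + (x / m) ^ 2) = energy m x / m := by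
    intro x
    rw [energy, show 1 + (x / m) ^ 2 = (x ^ 2 + m ^ 2) / m ^ 2 by field_simp; ring,
      Real.sqrt_div (by positivity), Real.sqrt_sq hm.le]
  rw [← Real.arsinh_sinh (Real.arsinh (p / m) - Real.arsinh (q / m)), Real.sinh_sub,
    Real.sinh_arsinh, Real.sinh_arsinh, Real.cosh_arsinh, Real.cosh_arsinh, h, h]
  congr 1
  field_simp

/-- This isolates the divergent term -log m, which drops out of differences of rapidities. -/
theorem arsinh_div_eq_log {m p : ℝ} (hm : 0 < m) (hp : 0 < p) :
    Real.arsinh (p / m) = Real.log (p + energy m p) - Real.log m := by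
  have he : 0 ≤ energy m p := Real.sqrt_nonneg _
  rw [Real.arsinh, ← Real.log_div (by positivity) hm.ne', add_div]
  congr 2
  rw [energy, show 1 + (p / m) ^ 2 = (p ^ 2 + m ^ 2) / m ^ 2 by field_simp; ring,
    Real.sqrt_div (by positivity), Real.sqrt_sq hm.le]

theorem continuous_energy_mass (p : ℝ) : Continuous fun m => energy m p := by
  unfold energy; fun_prop

theorem energy_zero (p : ℝ) : energy 0 p = |p| := by
  simp [energy, Real.sqrt_sq_eq_abs]

theorem tendsto_arsinh_sub {p q : ℝ} (hp : 0 < p) (hq : 0 < q) :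
    Tendsto (fun m : ℝ => Real.arsinh (p / m) - Real.arsinh (q / m)) (𝓝[>] 0)
      (𝓝 (Real.log p - Real.log q)) := by
  have h : ∀ x : ℝ, 0 < x → Tendsto (fun m : ℝ => Real.log (x + energy m x)) (𝓝[>] 0)
      (𝓝 (Real.log (x + x))) := by
    intro x hx
    have h1 : Tendsto (fun m : ℝ => x + energy m x) (𝓝[>] 0) (𝓝 (x + x)) := by
      have := ((continuous_energy_mass x).tendsto 0).const_add x
      rw [energy_zero, abs_of_pos hx] at this
      exact this.mono_left nhdsWithin_le_nhds
    exact h1.log (by positivity)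
  have h2 := (h p hp).sub (h q hq)
  -- For positive x the sum x + ω_x tends to 2x, and the factor 2 cancels in the difference.
  have e : Real.log (p + p) - Real.log (q + q) = Real.log p - Real.log q := by
    rw [← two_mul, ← two_mul, Real.log_mul two_ne_zero hp.ne', Real.log_mul two_ne_zero hq.ne']
    ring
  rw [e] at h2
  refine h2.congr' ?_
  filter_upwards [self_mem_nhdsWithin] with m hm
  rw [arsinh_div_eq_log hm hp, arsinh_div_eq_log hm hq]
  ring

theorem tendsto_arsinh_div_atTop {p : ℝ} (hp : 0 < p) :
    Tendsto (fun m : ℝ => Real.arsinh (p / m)) (𝓝[>] 0) atTop :=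
  (Real.arsinh_strictMono.monotone.tendsto_atTop_atTop fun b =>
    ⟨Real.sinh b, (Real.arsinh_sinh b).ge⟩).comp
    (tendsto_inv_nhdsGT_zero.const_mul_atTop hp)

/-- Equal signs give a finite limit of the rapidity difference; opposite signs drive it to ±∞, where
the limits of S take over. Zero momenta may be left out because they form a null set in every later
integration. -/
theorem tendsto_kernel {S : ℂ → ℂ} (hS : IsScatteringFunctionWithLimit S) {p q : ℝ}
    (hp : p ≠ 0) (hq : q ≠ 0) :
    Tendsto (fun m => kernel S m p q) (𝓝[>] 0) (𝓝 (kernel S 0 p q)) := by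
  have hc := continuous_scattering hS.toIsScatteringFunction
  suffices h : Tendsto (fun m : ℝ => S ((Real.arsinh (p / m) - Real.arsinh (q / m) : ℝ) : ℂ))
      (𝓝[>] 0) (𝓝 (kernel S 0 p q)) by
    refine h.congr' ?_
    filter_upwards [self_mem_nhdsWithin] with m hm
    rw [kernel_of_ne_zero S (ne_of_gt hm), massiveKernel, arsinh_rapidity hm]
  have hneg : ∀ x m : ℝ, Real.arsinh (x / m) = -Real.arsinh (-x / m) := fun x m => by
    rw [neg_div, Real.arsinh_neg, neg_neg]
  rw [kernel_zero, masslessKernel]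
  rcases lt_or_gt_of_ne hp with hp' | hp' <;> rcases lt_or_gt_of_ne hq with hq' | hq'
  · rw [if_neg (fun h => hp'.not_gt h.1), if_pos ⟨hp', hq'⟩]
    refine (hc.tendsto _).comp ((tendsto_arsinh_sub (neg_pos.2 hq') (neg_pos.2 hp')).congr
      fun m => ?_)
    rw [hneg p, hneg q]
    ring
  · rw [if_neg (fun h => hp'.not_gt h.1), if_neg (fun h => hq'.not_gt h.2),
      if_neg (fun h => hp h.1)]
    -- For p < 0 < q the rapidity difference tends to -∞, while the massless kernel is S(∞);
    -- equality of the two limits of S enters here.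
    refine (tendsto_limitValue_atBot hS).comp ?_
    refine (tendsto_neg_atTop_atBot.comp ((tendsto_arsinh_div_atTop (neg_pos.2 hp')).atTop_add_atTop
      (tendsto_arsinh_div_atTop hq'))).congr fun m => ?_
    rw [hneg p, Function.comp_apply]
    ring
  · rw [if_neg (fun h => hq'.not_gt h.2), if_neg (fun h => hp'.not_gt h.1),
      if_neg (fun h => hp h.1)]
    refine (tendsto_limitValue_atTop hS).comp ?_
    refine ((tendsto_arsinh_div_atTop hp').atTop_add_atTop
      (tendsto_arsinh_div_atTop (neg_pos.2 hq'))).congr fun m => ?_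
    rw [hneg q]
    ring
  · rw [if_pos ⟨hp', hq'⟩]
    exact (hc.tendsto _).comp (tendsto_arsinh_sub hp' hq')

/-! ### Scaling -/

theorem integral_momentumMeasure (m : ℝ) (g : ℝ → ℂ) :
    ∫ q, g q ∂(momentumMeasure m) = ∫ q, (energy m q)⁻¹ • g q := by
  have he : Measurable fun q => ENNReal.ofReal (energy m q)⁻¹ := by
    unfold energy; fun_prop
  rw [momentumMeasure, integral_withDensity_eq_integral_toReal_smul he (by simp)]
  refine integral_congr_ae (Eventually.of_forall fun q => ?_)
  simp only [ENNReal.toReal_ofReal (inv_nonneg.2 (Real.sqrt_nonneg (q ^ 2 + m ^ 2))), energy]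

/-- Substituting x = l y, the Jacobian l² cancels the prefactor l⁻², and the phase transforms by
homogeneity of the energy. -/
theorem massShell_rescale {l : ℝ} (hl : 0 < l) (ε m : ℝ) (f : 𝓢(Spacetime, ℂ)) (p : ℝ) :
    massShell ε m (rescale l f) p = massShell ε (l * m) f (l * p) := by
  have h := Measure.integral_comp_inv_smul (volume : Measure Spacetime)
    (fun y => f y * Complex.exp (ε * Complex.I *
      (energy (l * m) (l * p) * y 0 - l * p * y 1 : ℝ))) l
  rw [massShell, massShell]
  congr 1
  have hl2 : (l : ℂ) ^ 2 ≠ 0 := by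
    have : (l : ℂ) ≠ 0 := by exact_mod_cast hl.ne'
    positivity
  have e : ∀ x : Spacetime, rescale l f x *
      Complex.exp (ε * Complex.I * (energy m p * x 0 - p * x 1 : ℝ))
      = ((l : ℂ) ^ 2)⁻¹ * (f (l⁻¹ • x) * Complex.exp (ε * Complex.I *
        (energy (l * m) (l * p) * (l⁻¹ • x) 0 - l * p * (l⁻¹ • x) 1 : ℝ))) := by
    intro x
    rw [rescale_apply hl, mul_assoc]
    congr 4
    rw [energy_mul hl, PiLp.smul_apply, PiLp.smul_apply, smul_eq_mul, smul_eq_mul]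
    have := hl.ne'
    congr 1
    field_simp
  simp only [e]
  rw [integral_const_mul, h, finrank_euclideanSpace_fin, abs_of_pos (by positivity),
    Complex.real_smul, ← mul_assoc, Complex.ofReal_pow, inv_mul_cancel₀ hl2, one_mul]

theorem createFun_scale {s t : ℝ → ℝ → ℂ} {φ ψ : ℝ → ℂ} {n : ℕ} {Ψ Φ : (Fin n → ℝ) → ℂ} {l : ℝ}
    (hs : ∀ p q, s p q = t (l * p) (l * q)) (hφ : ∀ p, φ p = ψ (l * p))
    (hΨ : ∀ p, Ψ p = Φ fun i => l * p i) (p : Fin (n + 1) → ℝ) :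
    createFun s φ Ψ p = createFun t ψ Φ fun i => l * p i := by
  simp only [createFun, insertTerm, hs, hφ, hΨ]
  rfl

theorem annihilateFun_scale {l : ℝ} (hl : 0 < l) (m : ℝ) {φ ψ : ℝ → ℂ} {n : ℕ}
    {Ψ Φ : (Fin (n + 1) → ℝ) → ℂ} (hφ : ∀ p, φ p = ψ (l * p))
    (hΨ : ∀ p, Ψ p = Φ fun i => l * p i) (p : Fin n → ℝ) :
    annihilateFun (μ := momentumMeasure m) φ Ψ p
      = annihilateFun (μ := momentumMeasure (l * m)) ψ Φ fun i => l * p i := by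
  rw [annihilateFun, annihilateFun, integral_momentumMeasure, integral_momentumMeasure]
  congr 1
  have h := Measure.integral_comp_mul_left (fun q => (energy (l * m) q)⁻¹ •
    (ψ q * Φ (Fin.cons q fun i => l * p i))) l
  -- Homogeneity of the energy gives the factor l, which compensates dq ↦ l⁻¹ dq: the measure dq/ω
  -- is scale invariant.
  have e : ∀ q, (energy m q)⁻¹ • (φ q * Ψ (Fin.cons q p)) = l • ((energy (l * m) (l * q))⁻¹ •
      (ψ (l * q) * Φ (Fin.cons (l * q) fun i => l * p i))) := by
    intro q
    have hc : (fun i => l * (Fin.cons q p : Fin (n + 1) → ℝ) i)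
        = (Fin.cons (l * q) fun i => l * p i : Fin (n + 1) → ℝ) := by
      funext i
      refine Fin.cases ?_ (fun i => ?_) i <;> simp
    rw [hφ, hΨ, hc, energy_mul hl, smul_smul, mul_inv, mul_inv_cancel_left₀ hl.ne']
  simp only [e]
  rw [integral_smul, h, smul_smul, abs_of_pos (inv_pos.2 hl), mul_inv_cancel₀ hl.ne', one_smul]

/-- The state functions at mass `m` and scale `l` are those at mass `l m`, rescaled. -/
theorem stateFun_rescale {l : ℝ} (hl : 0 < l) (S : ℂ → ℂ) {m : ℝ} (hm : m ≠ 0)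
    (fs : List 𝓢(Spacetime, ℂ)) (n : ℕ) (p : Fin n → ℝ) :
    stateFun S m (fs.map (rescale l)) n p = stateFun S (l * m) fs n fun i => l * p i := by
  induction fs generalizing n with
  | nil => rfl
  | cons f fs ih =>
    change fieldFun S m (rescale l f) (stateFun S m (fs.map (rescale l))) n p
      = fieldFun S (l * m) f (stateFun S (l * m) fs) n _
    rw [fieldFun, fieldFun, annihilateFun_scale hl m (massShell_rescale hl _ m f) (ih (n + 1))]
    congr 1
    cases n with
    | zero => rfl
    | succ k =>
      exact createFun_scale (fun p q => (kernel_mul hl S hm p q).symm)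
        (massShell_rescale hl _ m f) (ih k) p

/-! ### Uniform bounds -/

/-- The function `(ω_p^m / (1 + p²))^{1/2}`, which dominates `f^{m±}` uniformly in the mass. -/
def weight (m p : ℝ) : ℝ := √(energy m p * (1 + p ^ 2)⁻¹)

theorem energy_nonneg (m p : ℝ) : 0 ≤ energy m p := Real.sqrt_nonneg _

theorem weight_nonneg (m p : ℝ) : 0 ≤ weight m p := Real.sqrt_nonneg _

theorem weight_sq (m p : ℝ) : weight m p * weight m p = energy m p * (1 + p ^ 2)⁻¹ :=
  Real.mul_self_sqrt (mul_nonneg (energy_nonneg m p) (by positivity))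

theorem weight_mono {m m' : ℝ} (hm : 0 ≤ m) (h : m ≤ m') (p : ℝ) : weight m p ≤ weight m' p := by
  unfold weight energy
  gcongr

/-- The bound is the geometric mean of two others. Smoothness of the Fourier transform and its zero
at the origin give Bω; Schwartz decay gives a multiple of 1/(1+p²). Neither constant depends on the
mass. -/
theorem norm_massShell_le {ε : ℝ} (hε : ε ^ 2 = 1) (f : 𝓢(Spacetime, ℂ))
    (hf : massShell ε 0 f 0 = 0) :
    ∃ C, 0 ≤ C ∧ ∀ m p, ‖massShell ε m f p‖ ≤ C * weight m p := by
  obtain ⟨A, hA0, hA⟩ := (𝓕 f).decay 0 0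
  obtain ⟨A', hA0', hA'⟩ := (𝓕 f).decay 2 0
  obtain ⟨B, hB0, hB⟩ := (𝓕 f).decay 0 1
  have hsp : shellPoint ε 0 0 = 0 := by
    ext i
    fin_cases i <;> simp [shellPoint, energy]
  have h0 : 𝓕 f 0 = 0 := by
    rw [massShell_eq, hsp] at hf
    have hpi : (Real.pi : ℂ) ≠ 0 := by exact_mod_cast Real.pi_ne_zero
    simpa [hpi] using hf
  refine ⟨√(B * (A + 4 * Real.pi ^ 2 * A')), Real.sqrt_nonneg _, fun m p => ?_⟩
  set x := shellPoint ε m p with hx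
  have hpi := Real.pi_gt_three
  have hnorm : 4 * Real.pi ^ 2 * ‖x‖ ^ 2 = energy m p ^ 2 + p ^ 2 := by
    rw [EuclideanSpace.norm_sq_eq]
    simp only [hx, shellPoint, Fin.sum_univ_two, Real.norm_eq_abs, sq_abs,
      Matrix.cons_val_zero, Matrix.cons_val_one]
    have : 4 * Real.pi ^ 2 * ((-(ε * energy m p / (2 * Real.pi))) ^ 2 +
        (ε * p / (2 * Real.pi)) ^ 2) = ε ^ 2 * (energy m p ^ 2 + p ^ 2) := by
      field_simp
      ring
    rw [this, hε, one_mul]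
  have hp : p ^ 2 ≤ energy m p ^ 2 := by
    rw [energy, Real.sq_sqrt (by positivity)]
    nlinarith [sq_nonneg m]
  -- Here 4π²‖x‖² = ω² + p² ≤ 2ω², and 2 ≤ 4π².
  have hxe : ‖x‖ ≤ energy m p := by
    refine abs_le_of_sq_le_sq' ?_ (energy_nonneg m p) |>.2
    nlinarith [sq_nonneg ‖x‖, mul_le_mul_of_nonneg_right
      (show (2 : ℝ) ≤ 4 * Real.pi ^ 2 by nlinarith) (sq_nonneg ‖x‖)]
  have h1 := hA x
  have h2 := hA' x
  simp only [norm_iteratedFDeriv_zero, pow_zero, one_mul] at h1 h2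
  have h3 : ‖𝓕 f x - 𝓕 f 0‖ ≤ B * ‖x - 0‖ :=
    convex_univ.norm_image_sub_le_of_norm_fderiv_le (𝕜 := ℝ)
      (fun x _ => (𝓕 f).differentiableAt)
      (fun x _ => by simpa [norm_iteratedFDeriv_one] using hB x) (Set.mem_univ _)
      (Set.mem_univ _)
  rw [h0, sub_zero, sub_zero] at h3
  have h4 : ‖𝓕 f x‖ * (1 + p ^ 2) ≤ A + 4 * Real.pi ^ 2 * A' := by
    have hg := norm_nonneg (𝓕 f x)
    calc ‖𝓕 f x‖ * (1 + p ^ 2) ≤ ‖𝓕 f x‖ * (1 + 4 * Real.pi ^ 2 * ‖x‖ ^ 2) := by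
          gcongr
          rw [hnorm]
          nlinarith [sq_nonneg (energy m p)]
      _ = ‖𝓕 f x‖ + 4 * Real.pi ^ 2 * (‖x‖ ^ 2 * ‖𝓕 f x‖) := by ring
      _ ≤ _ := by gcongr
  have hc : ‖(1 / (2 * Real.pi) : ℂ)‖ ≤ 1 := by
    have : (1 / (2 * Real.pi) : ℂ) = ((1 / (2 * Real.pi) : ℝ) : ℂ) := by push_cast; rfl
    rw [this, Complex.norm_real, Real.norm_of_nonneg (by positivity), div_le_one (by positivity)]
    linarith
  have h5 : ‖massShell ε m f p‖ ≤ ‖𝓕 f x‖ := by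
    rw [massShell_eq, norm_mul]
    exact mul_le_of_le_one_left (norm_nonneg _) hc
  refine h5.trans ?_
  rw [weight, ← Real.sqrt_mul (by positivity)]
  refine Real.le_sqrt_of_sq_le ?_
  have h6 : ‖𝓕 f x‖ ≤ (A + 4 * Real.pi ^ 2 * A') * (1 + p ^ 2)⁻¹ := by
    rwa [← div_eq_mul_inv, le_div_iff₀ (by positivity)]
  calc ‖𝓕 f x‖ ^ 2 = ‖𝓕 f x‖ * ‖𝓕 f x‖ := sq _
    _ ≤ (B * energy m p) * ((A + 4 * Real.pi ^ 2 * A') * (1 + p ^ 2)⁻¹) := by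
      gcongr
      · have := energy_nonneg m p
        positivity
      · exact h3.trans (by gcongr)
    _ = _ := by ring

theorem norm_createFun_le {s : ℝ → ℝ → ℂ} (hs : ∀ p q, s p q * conj (s p q) = 1) {φ : ℝ → ℂ}
    {n : ℕ} {Ψ : (Fin n → ℝ) → ℂ} {w : ℝ → ℝ} (hw : ∀ p, 0 ≤ w p) {C K : ℝ}
    (hC : 0 ≤ C) (hφ : ∀ p, ‖φ p‖ ≤ C * w p)
    (hΨ : ∀ p, ‖Ψ p‖ ≤ K * ∏ i, w (p i)) (p : Fin (n + 1) → ℝ) :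
    ‖createFun s φ Ψ p‖ ≤ (√(n + 1))⁻¹ * ((n + 1) * (C * K)) * ∏ i, w (p i) := by
  rw [createFun, norm_mul, norm_inv, Complex.norm_real, Real.norm_of_nonneg (Real.sqrt_nonneg _),
    mul_assoc]
  gcongr
  have hterm : ∀ k ∈ (Finset.univ : Finset (Fin (n + 1))),
      ‖insertTerm s φ Ψ k p‖ ≤ C * K * ∏ i, w (p i) := by
    intro k _
    rw [insertTerm, norm_mul, norm_prod_eq_one hs, one_mul, norm_mul,
      Fin.prod_univ_succAbove (fun i => w (p i)) k]
    calc ‖φ (p k)‖ * ‖Ψ (k.removeNth p)‖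
        ≤ (C * w (p k)) * (K * ∏ i, w (p (k.succAbove i))) :=
          mul_le_mul (hφ _) (hΨ _) (norm_nonneg _) (mul_nonneg hC (hw _))
      _ = _ := by ring
  refine (norm_sum_le_of_le _ hterm).trans (le_of_eq ?_)
  rw [Finset.sum_const, Finset.card_univ, Fintype.card_fin, nsmul_eq_mul]
  push_cast
  ring

/-- The integrated variable contributes its weight twice, once from φ and once from Ψ, and the
square of the weight cancels 1/ω, leaving the integrable 1/(1+q²). -/
theorem norm_annihilate_integrand_le {m : ℝ} {φ : ℝ → ℂ} {n : ℕ} {Ψ : (Fin (n + 1) → ℝ) → ℂ}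
    {C K : ℝ} (hC : 0 ≤ C) (hK : 0 ≤ K) (hφ : ∀ p, ‖φ p‖ ≤ C * weight m p)
    (hΨ : ∀ p, ‖Ψ p‖ ≤ K * ∏ i, weight m (p i)) (p : Fin n → ℝ) (q : ℝ) :
    ‖(energy m q)⁻¹ • (φ q * Ψ (Fin.cons q p))‖
      ≤ C * K * (∏ i, weight m (p i)) * (1 + q ^ 2)⁻¹ := by
  have hP : 0 ≤ ∏ i, weight m (p i) := Finset.prod_nonneg fun i _ => weight_nonneg m _
  have he := energy_nonneg m q
  have h1 := hΨ (Fin.cons q p)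
  rw [Fin.prod_univ_succ] at h1
  simp only [Fin.cons_zero, Fin.cons_succ] at h1
  rw [norm_smul, norm_mul, Real.norm_of_nonneg (inv_nonneg.2 he)]
  calc (energy m q)⁻¹ * (‖φ q‖ * ‖Ψ (Fin.cons q p)‖)
      ≤ (energy m q)⁻¹ * ((C * weight m q) * (K * (weight m q * ∏ i, weight m (p i)))) := by
        refine mul_le_mul_of_nonneg_left ?_ (inv_nonneg.2 he)
        exact mul_le_mul (hφ q) h1 (norm_nonneg _) (mul_nonneg hC (weight_nonneg m q))
    _ = (energy m q)⁻¹ * (C * K * (∏ i, weight m (p i)) * (weight m q * weight m q)) := by ring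
    _ = ((energy m q)⁻¹ * energy m q) * (C * K * (∏ i, weight m (p i)) * (1 + q ^ 2)⁻¹) := by
        rw [weight_sq]; ring
    -- Only an inequality, because ω⁻¹ω is 0 rather than 1 where the energy vanishes (m = q = 0).
    _ ≤ 1 * (C * K * (∏ i, weight m (p i)) * (1 + q ^ 2)⁻¹) := by
        gcongr
        exact inv_mul_le_one
    _ = _ := one_mul _

theorem norm_annihilateFun_le {m : ℝ} {φ : ℝ → ℂ} {n : ℕ} {Ψ : (Fin (n + 1) → ℝ) → ℂ}
    {C K : ℝ} (hC : 0 ≤ C) (hK : 0 ≤ K) (hφ : ∀ p, ‖φ p‖ ≤ C * weight m p)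
    (hΨ : ∀ p, ‖Ψ p‖ ≤ K * ∏ i, weight m (p i)) (p : Fin n → ℝ) :
    ‖annihilateFun (μ := momentumMeasure m) φ Ψ p‖
      ≤ √(n + 1) * (C * K * Real.pi) * ∏ i, weight m (p i) := by
  rw [annihilateFun, integral_momentumMeasure, norm_mul, Complex.norm_real,
    Real.norm_of_nonneg (Real.sqrt_nonneg _), mul_assoc]
  gcongr
  refine (norm_integral_le_of_norm_le (integrable_inv_one_add_sq.const_mul _)
    (Eventually.of_forall (norm_annihilate_integrand_le hC hK hφ hΨ p))).trans (le_of_eq ?_)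
  rw [integral_const_mul, integral_univ_inv_one_add_sq]
  ring

/-- Creation and annihilation both preserve bounds by a product of weights. The point is that K does
not depend on m. -/
theorem norm_stateFun_le {S : ℂ → ℂ} (hS : IsScatteringFunctionWithLimit S)
    (fs : List 𝓢(Spacetime, ℂ))
    (hfs : ∀ f ∈ fs, massShell 1 0 f 0 = 0 ∧ massShell (-1) 0 f 0 = 0) (n : ℕ) :
    ∃ K, 0 ≤ K ∧ ∀ m p, ‖stateFun S m fs n p‖ ≤ K * ∏ i, weight m (p i) := by
  induction fs generalizing n with
  | nil =>
    refine ⟨1, zero_le_one, fun m p => ?_⟩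
    have hP : 0 ≤ ∏ i, weight m (p i) := Finset.prod_nonneg fun i _ => weight_nonneg m _
    change ‖vacuumFun n p‖ ≤ _
    cases n with
    | zero => simp [vacuumFun]
    | succ k => simpa [vacuumFun] using hP
  | cons f fs ih =>
    have ih' := ih fun g hg => hfs g (List.mem_cons_of_mem f hg)
    have hf := hfs f List.mem_cons_self
    obtain ⟨C, hC0, hC⟩ := norm_massShell_le (by norm_num) f hf.1
    obtain ⟨D, hD0, hD⟩ := norm_massShell_le (by norm_num) f hf.2
    obtain ⟨K, hK0, hK⟩ := ih' (n + 1)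
    have hann := fun m => norm_annihilateFun_le hD0 hK0 (hD m) (hK m)
    obtain ⟨K', hK0', hK'⟩ : ∃ K', 0 ≤ K' ∧ ∀ m p,
        ‖creationFun (kernel S m) (massShell 1 m f) (stateFun S m fs) n p‖
          ≤ K' * ∏ i, weight m (p i) := by
      cases n with
      | zero => exact ⟨0, le_rfl, fun m p => by simp [creationFun]⟩
      | succ k =>
        obtain ⟨K₁, hK₁0, hK₁⟩ := ih' k
        exact ⟨_, by positivity, fun m =>
          norm_createFun_le (kernel_unitary hS m) (weight_nonneg m) hC0 (hC m) (hK₁ m)⟩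
    refine ⟨K' + √(n + 1) * (D * K * Real.pi), by positivity, fun m p => ?_⟩
    rw [add_mul]
    exact (norm_add_le _ _).trans (add_le_add (hK' m p) (hann m p))

/-! ### Measurability and the massless limit -/

theorem measurable_createFun {s : ℝ → ℝ → ℂ} (hs : Measurable (Function.uncurry s)) {φ : ℝ → ℂ}
    (hφ : Measurable φ) {n : ℕ} {Ψ : (Fin n → ℝ) → ℂ} (hΨ : Measurable Ψ) :
    Measurable (createFun s φ Ψ) := by
  refine (Finset.measurable_fun_sum _ fun k _ => ?_).const_mul _
  refine (measurable_prod_kernel hs k).mul ((hφ.comp (measurable_pi_apply k)).mul (hΨ.comp ?_))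
  exact measurable_pi_lambda _ fun i => measurable_pi_apply _

theorem measurable_cons {n : ℕ} :
    Measurable fun z : (Fin n → ℝ) × ℝ => (Fin.cons z.2 z.1 : Fin (n + 1) → ℝ) := by
  refine measurable_pi_lambda _ fun i => ?_
  refine Fin.cases ?_ (fun i => ?_) i
  · simpa using measurable_snd
  · simp only [Fin.cons_succ]
    exact (measurable_pi_apply i).comp measurable_fst

theorem measurable_annihilateFun {μ : Measure ℝ} [SigmaFinite μ] {φ : ℝ → ℂ} (hφ : Measurable φ)
    {n : ℕ} {Ψ : (Fin (n + 1) → ℝ) → ℂ} (hΨ : Measurable Ψ) :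
    Measurable (annihilateFun (μ := μ) φ Ψ) := by
  refine Measurable.const_mul ?_ _
  have h : Measurable fun z : (Fin n → ℝ) × ℝ => φ z.2 * Ψ (Fin.cons z.2 z.1) :=
    (hφ.comp measurable_snd).mul (hΨ.comp measurable_cons)
  exact (h.stronglyMeasurable.integral_prod_right').measurable

theorem measurable_stateFun {S : ℂ → ℂ} (hS : IsScatteringFunctionWithLimit S) (m : ℝ)
    (fs : List 𝓢(Spacetime, ℂ)) (n : ℕ) : Measurable (stateFun S m fs n) := by
  induction fs generalizing n with
  | nil => exact measurable_const
  | cons f fs ih =>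
    refine Measurable.add ?_
      (measurable_annihilateFun (continuous_massShell _ m f).measurable (ih (n + 1)))
    cases n with
    | zero => exact measurable_const
    | succ k =>
      exact measurable_createFun (measurable_kernel hS m) (continuous_massShell _ m f).measurable
        (ih k)

theorem tendsto_massShell (ε : ℝ) (f : 𝓢(Spacetime, ℂ)) (p : ℝ) :
    Tendsto (fun m => massShell ε m f p) (𝓝[>] 0) (𝓝 (massShell ε 0 f p)) := by
  have h : Continuous fun m => massShell ε m f p := by
    simp only [massShell_eq]
    refine continuous_const.mul ((𝓕 f).continuous.comp ?_)
    unfold shellPoint energy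
    fun_prop
  exact (h.tendsto 0).mono_left nhdsWithin_le_nhds

theorem tendsto_createFun {S : ℂ → ℂ} (hS : IsScatteringFunctionWithLimit S)
    (f : 𝓢(Spacetime, ℂ)) {n : ℕ} {F : ℝ → (Fin n → ℝ) → ℂ}
    (hF : ∀ p : Fin n → ℝ, (∀ i, p i ≠ 0) → Tendsto (fun m => F m p) (𝓝[>] 0) (𝓝 (F 0 p)))
    (p : Fin (n + 1) → ℝ) (hp : ∀ i, p i ≠ 0) :
    Tendsto (fun m => createFun (kernel S m) (massShell 1 m f) (F m) p) (𝓝[>] 0)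
      (𝓝 (createFun (kernel S 0) (massShell 1 0 f) (F 0) p)) := by
  refine (tendsto_finsetSum _ fun k _ => ?_).const_mul _
  refine (tendsto_finsetProd _ fun l _ => tendsto_kernel hS (hp k) (hp l)).mul
    ((tendsto_massShell 1 f (p k)).mul (hF _ fun i => hp _))

/-- Dominated convergence; writing the integral against Lebesgue measure moves the mass dependence
of dq/ω into the integrand. -/
theorem tendsto_annihilateFun (f : 𝓢(Spacetime, ℂ)) (hf : massShell (-1) 0 f 0 = 0) {n : ℕ}
    {F : ℝ → (Fin (n + 1) → ℝ) → ℂ} (hm : ∀ m, Measurable (F m))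
    {K : ℝ} (hK : 0 ≤ K) (hFK : ∀ m p, ‖F m p‖ ≤ K * ∏ i, weight m (p i))
    (hF : ∀ p : Fin (n + 1) → ℝ, (∀ i, p i ≠ 0) → Tendsto (fun m => F m p) (𝓝[>] 0) (𝓝 (F 0 p)))
    (p : Fin n → ℝ) (hp : ∀ i, p i ≠ 0) :
    Tendsto (fun m => annihilateFun (μ := momentumMeasure m) (massShell (-1) m f) (F m) p) (𝓝[>] 0)
      (𝓝 (annihilateFun (μ := momentumMeasure 0) (massShell (-1) 0 f) (F 0) p)) := by
  obtain ⟨C, hC0, hC⟩ := norm_massShell_le (by norm_num) f hf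
  simp only [annihilateFun, integral_momentumMeasure]
  refine Tendsto.const_mul _ ?_
  refine tendsto_integral_filter_of_dominated_convergence
    (fun q => C * K * (∏ i, weight 1 (p i)) * (1 + q ^ 2)⁻¹) ?_ ?_
    (integrable_inv_one_add_sq.const_mul _) ?_
  · refine Eventually.of_forall fun m => Measurable.aestronglyMeasurable ?_
    have he : Measurable fun q => (energy m q)⁻¹ := by
      unfold energy; fun_prop
    exact he.smul ((continuous_massShell _ m f).measurable.mul
      ((hm m).comp (measurable_cons.comp measurable_prodMk_left)))
  -- The weight increases with the mass, so for 0 < m ≤ 1 the weight at mass 1 serves as a common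
  -- bound.
  · filter_upwards [Ioc_mem_nhdsGT one_pos] with m hm1
    refine Eventually.of_forall fun q =>
      (norm_annihilate_integrand_le hC0 hK (hC m) (hFK m) p q).trans ?_
    gcongr with i
    · exact fun i _ => weight_nonneg m _
    · exact weight_mono hm1.1.le hm1.2 _
  -- The point q = 0, where the massless energy vanishes, is discarded as a null set; this also
  -- keeps all momenta nonzero as the hypothesis on F requires.
  · filter_upwards [compl_mem_ae_iff.2 (measure_singleton (0 : ℝ))] with q hq
    have hq0 : q ≠ 0 := hq
    have he : Tendsto (fun m => (energy m q)⁻¹) (𝓝[>] 0) (𝓝 (energy 0 q)⁻¹) := by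
      refine Tendsto.inv₀ (((continuous_energy_mass q).tendsto 0).mono_left nhdsWithin_le_nhds) ?_
      rw [energy_zero]
      exact abs_ne_zero.2 hq0
    refine he.smul ((tendsto_massShell (-1) f q).mul (hF _ fun i => ?_))
    refine Fin.cases ?_ (fun i => ?_) i
    · simpa using hq0
    · simpa using hp i

/-- The state functions converge pointwise in the massless limit. -/
theorem tendsto_stateFun {S : ℂ → ℂ} (hS : IsScatteringFunctionWithLimit S)
    (fs : List 𝓢(Spacetime, ℂ))
    (hfs : ∀ f ∈ fs, massShell 1 0 f 0 = 0 ∧ massShell (-1) 0 f 0 = 0) (n : ℕ) (p : Fin n → ℝ)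
    (hp : ∀ i, p i ≠ 0) :
    Tendsto (fun m => stateFun S m fs n p) (𝓝[>] 0) (𝓝 (stateFun S 0 fs n p)) := by
  -- The particle number is left free because a field couples the n-particle component to those with
  -- n-1 and n+1 particles.
  induction fs generalizing n with
  | nil => exact tendsto_const_nhds
  | cons f fs ih =>
    have hfs' := fun g hg => hfs g (List.mem_cons_of_mem f hg)
    obtain ⟨K, hK0, hK⟩ := norm_stateFun_le hS fs hfs' (n + 1)
    refine Tendsto.add ?_ (tendsto_annihilateFun f (hfs f List.mem_cons_self).2
      (fun m => measurable_stateFun hS m fs (n + 1)) hK0 hK (ih hfs' (n + 1)) p hp)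
    cases n with
    | zero => exact tendsto_const_nhds
    | succ k => exact tendsto_createFun hS f (ih hfs' k) p hp

/-! ### The scaling limit of the n-point functions. -/

theorem tendsto_nPoint {m : ℝ} (hm : 0 < m) {S : ℂ → ℂ} (hS : IsScatteringFunctionWithLimit S)
    {n : ℕ} (f : Fin n → 𝓢(Spacetime, ℂ))
    (hf : ∀ j, massShell 1 0 (f j) 0 = 0 ∧ massShell (-1) 0 (f j) 0 = 0) :
    Tendsto (fun l : ℝ => nPoint S m l f) (𝓝[>] 0) (𝓝 (nPoint S 0 1 f)) := by
  have h0 : nPoint S 0 1 f = stateFun S 0 (List.ofFn f) 0 ![] := by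
    rw [nPoint_eq_stateFun (kernel_unitary hS 0) (kernel_mul_swap hS 0) (measurable_kernel hS 0)]
    · simp only [rescale_one]
    · intro j
      rw [rescale_one]
      exact ⟨memLp_massShell_zero (by norm_num) _ (hf j).1,
        memLp_massShell_zero (by norm_num) _ (hf j).2⟩
  -- Scale l at mass m corresponds to scale 1 at mass lm, which tends to 0 from above.
  have hlim : Tendsto (fun l : ℝ => l * m) (𝓝[>] 0) (𝓝[>] 0) := by
    refine tendsto_nhdsWithin_iff.2 ⟨?_, ?_⟩
    · have : Tendsto (fun l : ℝ => l * m) (𝓝 0) (𝓝 (0 * m)) := tendsto_id.mul_const m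
      rw [zero_mul] at this
      exact this.mono_left nhdsWithin_le_nhds
    · filter_upwards [self_mem_nhdsWithin] with l hl
      exact mul_pos hl hm
  rw [h0]
  refine ((tendsto_stateFun hS (List.ofFn f) (fun g hg => ?_) 0 ![] (fun i => i.elim0)).comp
    hlim).congr' ?_
  · obtain ⟨j, rfl⟩ := (List.mem_ofFn' _ _).1 hg
    exact hf j
  · filter_upwards [self_mem_nhdsWithin] with l hl
    -- At positive mass square integrability holds for every test function, so the rescaled ones
    -- need no separate vanishing condition.
    rw [nPoint_eq_stateFun (kernel_unitary hS m) (kernel_mul_swap hS m) (measurable_kernel hS m) l f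
      fun j => ⟨memLp_massShell_of_pos (by norm_num) hm _,
        memLp_massShell_of_pos (by norm_num) hm _⟩]
    have e : (List.ofFn fun j => rescale l (f j)) = (List.ofFn f).map (rescale l) := by
      rw [List.map_ofFn]; rfl
    rw [e, stateFun_rescale hl S hm.ne', Function.comp_apply]
    congr 1
    exact Subsingleton.elim _ _

theorem tendsto_reflectedNPoint {m : ℝ} (hm : 0 < m) {S : ℂ → ℂ}
    (hS : IsScatteringFunctionWithLimit S) {n : ℕ} (f : Fin n → 𝓢(Spacetime, ℂ))
    (hf : ∀ j, massShell 1 0 (f j) 0 = 0 ∧ massShell (-1) 0 (f j) 0 = 0) :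
    Tendsto (fun l : ℝ => reflectedNPoint hS m l f) (𝓝[>] 0)
      (𝓝 (reflectedNPoint hS 0 1 f)) := by
  have h := tendsto_nPoint hm hS (fun j => reflect (f j)) fun j =>
    ⟨massShell_reflect_zero (hf j).1, massShell_reflect_zero (hf j).2⟩
  rw [reflectedNPoint_eq hS 0 1 f fun j => reflect_rescale one_pos (f j)]
  refine ((Complex.continuous_conj.tendsto _).comp h).congr' ?_
  filter_upwards [self_mem_nhdsWithin] with l hl
  exact (reflectedNPoint_eq hS m l f fun j => reflect_rescale hl (f j)).symm

end

end FactorizingModel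

theorem mainTheorem7 (m : ℝ) (hm : 0 < m) (S : ℂ → ℂ)
    (hS : FactorizingModel.IsScatteringFunctionWithLimit S)
    (n : ℕ) (f : Fin n → 𝓢(FactorizingModel.Spacetime, ℂ))
    (hf : ∀ j, FactorizingModel.massShell 1 0 (f j) 0 = 0 ∧
      FactorizingModel.massShell (-1) 0 (f j) 0 = 0) :
    Tendsto (fun l : ℝ => FactorizingModel.nPoint S m l f) (𝓝[>] 0)
        (𝓝 (FactorizingModel.nPoint S 0 1 f)) ∧
      Tendsto (fun l : ℝ => FactorizingModel.reflectedNPoint hS m l f) (𝓝[>] 0)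
        (𝓝 (FactorizingModel.reflectedNPoint hS 0 1 f)) := by
  exact ⟨FactorizingModel.tendsto_nPoint hm hS f hf,
    FactorizingModel.tendsto_reflectedNPoint hm hS f hf⟩
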